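/- Let $a,b$ be real numbers with $0<b<\tfrac12<a<1$ and $a+b>1$. Let $\Delta_1$ be a one-element set and, inductively for $n\ge 1$, let $\Gamma_n=\bigcup_{k=1}^{n}\Delta_k$ and $$\Delta_{n+1}=\{n+1\}\times\bigcup_{1\le k<n}\{k\}\times\Gamma_k\times\Gamma_n\times\{\pm1\}\times\{\pm1\},\qquad \Gamma=\bigcup_{n\ge1}\Gamma_n .$$ Define linear maps $i_n:\ell_\infty(\Gamma_n)\to\ell_\infty(\Gamma_{n+1})$ inductively by $(i_nx)(\gamma)=x(\gamma)$ for $\gamma\in\Gamma_n$ and $$(i_nx)(n+1,k,\xi,\eta,\varepsilon,\varepsilon')=\varepsilon a\,x(\xi)+\varepsilon' b\,\bigl[x(\eta)-(i_{k,n}(x|_{\Gamma_k}))(\eta)\bigr],$$ where $i_{k,n}=i_{n-1}\circ\dots\circ i_k$, and let $j_m:\ell_\infty(\Gamma_m)\to\ell_\infty(\Gamma)$ be given by $(j_mx)(\delta)=(i_{m,n}x)(\delta)$ whenever $n\ge m$ and $\delta\in\Gamma_n$. The (real) Bourgain–Delbaen space $X=X_{a,b}$ of class $\mathcal Y$ is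 the closure of $\bigcup_{n\ge1}\operatorname{im} j_n$ in $\ell_\infty(\Gamma)$. Write $\mathcal L(X)$ for the bounded linear operators on $X$ with the operator norm and $\mathcal K(X)$ for the compact ones. Then: 1. not every $T\in\mathcal L(X)$ is of the form $\lambda I+K$ with $\lambda\in\mathbb R$ and $K\in\mathcal K(X)$; 2. $X^*$ is isomorphic, as a Banach space, to $\ell_1$; 3. $X$ has a Schauder basis; 4. $\mathbb R I+\mathcal K(X)=\{\lambda I+K:\lambda\in\mathbb R,\ K\in\mathcal K(X)\}$ is norm-separable; 5. $\mathcal L(X)$ is not norm-separable. -/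

import Mathlib

open scoped ENNReal

noncomputable section

namespace BourgainDelbaen

/-- The set `Δ_r` of indices of rank `r`. There is one element of rank `1`, and the elements of
rank `n + 1` with `n ≥ 1` are the tuples `(n + 1, k, ξ, η, ε, ε')` with `1 ≤ k < n`, `ξ ∈ Γ_k`,
`η ∈ Γ_n` and signs `ε, ε'`; here `ξ ∈ Γ_k` is given by its rank `r ≤ k` together with `ξ ∈ Δ_r`,
and likewise for `η`. -/
inductive Delta : ℕ → Type
  | base : Delta 1
  | node {n : ℕ} (k : ℕ) (hk : 1 ≤ k) (hkn : k < n) {r s : ℕ} (hr : r ≤ k) (hs : s ≤ n)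
      (ξ : Delta r) (η : Delta s) (ε ε' : ℤˣ) : Delta (n + 1)

/-- `Γ = ⋃_n Δ_n`, a disjoint union: an element is its rank `n` together with a point of `Δ_n`. -/
abbrev Gam : Type := Σ n : ℕ, Delta n

/-- `Γ_n = Δ_1 ∪ … ∪ Δ_n`. It is a finite set, so that `ℓ_∞(Γ_n)` is the space of all functions
`GamLE n → ℝ`. -/
abbrev GamLE (n : ℕ) : Type := {γ : Gam // γ.1 ≤ n}

/-- The restriction `π_k : ℓ_∞(Γ_n) → ℓ_∞(Γ_k)` for `k ≤ n`. -/
def restr {k n : ℕ} (h : k ≤ n) (x : GamLE n → ℝ) : GamLE k → ℝ :=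
  fun γ => x ⟨γ.1, γ.2.trans h⟩

/-- The map `u_n : ℓ_∞(Γ_n) → ℓ_∞(Δ_{n+1})`,
`(u_n x)(n+1, k, ξ, η, ε, ε') = ε a x(ξ) + ε' b (x(η) - (i_{k,n} π_k x)(η))`,
where the maps `I k = i_{k,n}` with `k < n` are already known. The clause for `base` concerns
`n = 0` only, where `Γ_0` is empty. -/
def uMap (a b : ℝ) : (n : ℕ) → (I : (k : ℕ) → (GamLE k → ℝ) → (GamLE n → ℝ)) →
    (GamLE n → ℝ) → Delta (n + 1) → ℝ
  | _, _, _, .base => 0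
  | _, I, x, .node k _ hkn hr hs ξ η ε ε' =>
      ((ε : ℤ) : ℝ) * a * x ⟨⟨_, ξ⟩, hr.trans hkn.le⟩ +
        ((ε' : ℤ) : ℝ) * b * (x ⟨⟨_, η⟩, hs⟩ - I k (restr hkn.le x) ⟨⟨_, η⟩, hs⟩)

/-- The map `i_n : ℓ_∞(Γ_n) → ℓ_∞(Γ_{n+1})`, which extends `x` by `u_n x` on `Δ_{n+1}`. -/
def stepMap (a b : ℝ) (n : ℕ) (I : (k : ℕ) → (GamLE k → ℝ) → (GamLE n → ℝ))
    (x : GamLE n → ℝ) : GamLE (n + 1) → ℝ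
  | ⟨⟨r, δ⟩, hr⟩ =>
      if h : r ≤ n then x ⟨⟨r, δ⟩, h⟩
      else uMap a b n I x ((Nat.le_antisymm hr (Nat.lt_of_not_le h)) ▸ δ)

/-- `iMap a b n k` is the map `i_{k,n} = i_{n-1} ∘ ⋯ ∘ i_k : ℓ_∞(Γ_k) → ℓ_∞(Γ_n)` for `k ≤ n`
(the identity for `k = n`). For `n < k`, which the construction never uses, it is the restriction
to `Γ_n`. -/
def iMap (a b : ℝ) : (n k : ℕ) → (GamLE k → ℝ) → (GamLE n → ℝ)
  | 0, _ => restr (Nat.zero_le _)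
  | n + 1, k =>
      if h : n + 1 ≤ k then restr h
      else fun x => stepMap a b n (iMap a b n) (iMap a b n k x)

/-- The extension map `j_m : ℓ_∞(Γ_m) → ℝ^Γ`. The value at `δ` is that of `i_{m,n} x` for any
`n ≥ m` with `δ ∈ Γ_n`; the choice here is `n = max m (rank δ)`. -/
def jMap (a b : ℝ) (m : ℕ) (x : GamLE m → ℝ) : Gam → ℝ :=
  fun δ => iMap a b (max m δ.1) m x ⟨δ, le_max_right _ _⟩

/-- The Bourgain–Delbaen space `X_{a,b}`: the closed linear span in `ℓ_∞(Γ)` of the images of the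
maps `j_n`, `n ≥ 1`. (For the admissible parameters these images form an increasing sequence of
subspaces of `ℓ_∞(Γ)`, and the closed linear span is the closure of their union.) -/
def space (a b : ℝ) : Submodule ℝ (lp (fun _ : Gam => ℝ) ∞) :=
  (Submodule.span ℝ {f : lp (fun _ : Gam => ℝ) ∞ |
    ∃ (n : ℕ) (_ : 1 ≤ n) (x : GamLE n → ℝ), ∀ γ : Gam, f γ = jMap a b n x γ}).topologicalClosure

/-- The parameters `(a, b)` for which `X_{a,b}` is a Bourgain–Delbaen space of class `𝒴`. -/
def ClassY (a b : ℝ) : Prop :=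
  0 < b ∧ b < 1 / 2 ∧ 1 / 2 < a ∧ a < 1 ∧ 1 < a + b

/-- `ℝ I + 𝒦(E)`: the operators on `E` that are a scalar multiple of the identity plus a compact
operator. -/
def scalarPlusCompact (E : Type*) [NormedAddCommGroup E] [NormedSpace ℝ E] : Set (E →L[ℝ] E) :=
  {T | ∃ (c : ℝ) (K : E →L[ℝ] E), IsCompactOperator K ∧ T = c • ContinuousLinearMap.id ℝ E + K}

end BourgainDelbaen

end

/-! Write `P_k x = j_k (x|Γ_k)` (`proj`, `projL`, `projX`). These projections satisfy `P_l P_k =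
P_{min(l,k)}`, are bounded by `1/(1-2b)` (`abs_proj_le`), have finite rank and converge pointwise to
the identity on `X`. The rest follows from this decomposition and from the signs `ε, ε'`.

Non-separability of the operators: a sequence of signs `t` acts on `Γ`, changing `ε, ε'` so that the
weighted composition `x ↦ t(rank γ) x(t·γ)` commutes with every `P_k` (`proj_signMap`). It therefore
acts on `X`, and uncountably many sign sequences give operators at mutual distance at least `1-2b`.

The dual: sums of `N` bounded blocks grow at most like `N^q` with `q < 1` (`abs_sum_blocks_le`), so
the decomposition is shrinking and the evaluations at points of `Γ` span a dense subspace of `X*`.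
Any pattern of signs on `Γ_n` extends to a vector of `X` with norm at most `1/(1-2b)`, so the
evaluations are equivalent to the unit vector basis of `ℓ_1`.

Since `X*` is separable and `P_n T → T` in norm for compact `T`, the scalar plus compact operators
form a separable set, so they cannot exhaust `L(X)`. The basis consists of the vectors `P_n e_γ`,
with `γ` of rank `n`, ordered by rank. -/

noncomputable section

namespace BourgainDelbaen

open Filter Topology

variable {a b : ℝ}

/-! ### Extension maps as commuting projections -/

/-- Strong induction on the rank of an index. -/
theorem Gam.rank_induction {p : Gam → Prop} (base : p ⟨1, .base⟩)
    (node : ∀ (n k : ℕ) (hk : 1 ≤ k) (hkn : k < n) (r s : ℕ) (hr : r ≤ k) (hs : s ≤ n)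
      (ξ : Delta r) (η : Delta s) (ε ε' : ℤˣ), (∀ γ : Gam, γ.1 ≤ n → p γ) →
      p ⟨n + 1, .node k hk hkn hr hs ξ η ε ε'⟩) (γ : Gam) : p γ := by
  have key : ∀ n : ℕ, ∀ γ : Gam, γ.1 ≤ n → p γ := by
    intro n
    induction n with
    | zero =>
      rintro ⟨m, δ⟩ h
      cases δ with
      | base => exact absurd h (by simp)
      | node => exact absurd h (by simp)
    | succ n ih =>
      rintro ⟨m, δ⟩ h
      cases δ with
      | base => exact base
      | @node m k hk hkn r s hr hs ξ η ε ε' =>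
        exact node m k hk hkn r s hr hs ξ η ε ε' fun γ hγ => ih γ (by simp at h; omega)
  exact key γ.1 γ le_rfl

theorem Gam.one_le_rank (γ : Gam) : 1 ≤ γ.1 := by
  obtain ⟨n, δ⟩ := γ
  cases δ <;> simp

theorem iMap_of_le (a b : ℝ) {n k : ℕ} (h : n ≤ k) : iMap a b n k = restr h := by
  cases n with
  | zero => rfl
  | succ n => rw [iMap, dif_pos h]

theorem iMap_succ (a b : ℝ) {n k : ℕ} (h : k ≤ n) (x : GamLE k → ℝ) :
    iMap a b (n + 1) k x = stepMap a b n (iMap a b n) (iMap a b n k x) := by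
  rw [iMap, dif_neg (by omega)]

theorem iMap_succ_apply (a b : ℝ) {n k : ℕ} (h : k ≤ n) (x : GamLE k → ℝ) (γ : Gam)
    (hγ : γ.1 ≤ n) :
    iMap a b (n + 1) k x ⟨γ, hγ.trans n.le_succ⟩ = iMap a b n k x ⟨γ, hγ⟩ := by
  rw [iMap_succ a b h, stepMap, dif_pos hγ]

theorem iMap_apply_of_le (a b : ℝ) {n m k : ℕ} (h : k ≤ n) (hnm : n ≤ m) (x : GamLE k → ℝ)
    (γ : Gam) (hγ : γ.1 ≤ n) :
    iMap a b m k x ⟨γ, hγ.trans hnm⟩ = iMap a b n k x ⟨γ, hγ⟩ := by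
  induction m, hnm using Nat.le_induction with
  | base => rfl
  | succ m hnm ih => rw [iMap_succ_apply a b (h.trans hnm) x γ (hγ.trans hnm), ih]

theorem iMap_eq_jMap (a b : ℝ) {n k : ℕ} (h : k ≤ n) (x : GamLE k → ℝ) (γ : GamLE n) :
    iMap a b n k x γ = jMap a b k x γ := by
  obtain ⟨γ, hγ⟩ := γ
  exact iMap_apply_of_le a b (le_max_left k γ.1) (max_le h hγ) x γ (le_max_right _ _)

/-- The projection `x ↦ j_k (x|Γ_k)`, on all functions on `Γ`. -/
def proj (a b : ℝ) (k : ℕ) (x : Gam → ℝ) : Gam → ℝ := jMap a b k fun γ => x γ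

theorem proj_congr {k : ℕ} {x y : Gam → ℝ} (h : ∀ γ : Gam, γ.1 ≤ k → x γ = y γ) :
    proj a b k x = proj a b k y := by
  unfold proj
  congr 1
  ext γ
  exact h γ γ.2

theorem proj_apply_of_le {k : ℕ} (x : Gam → ℝ) {γ : Gam} (h : γ.1 ≤ k) :
    proj a b k x γ = x γ := by
  rw [proj, ← iMap_eq_jMap a b le_rfl _ ⟨γ, h⟩, iMap_of_le a b le_rfl]
  rfl

theorem jMap_eq_proj (k : ℕ) (x : GamLE k → ℝ) : ∃ y : Gam → ℝ, jMap a b k x = proj a b k y := by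
  refine ⟨fun γ => if h : γ.1 ≤ k then x ⟨γ, h⟩ else 0, ?_⟩
  unfold proj
  congr 1
  ext γ
  simp [γ.2]

/-- The defining recursion in terms of the projections alone. The subtracted term stays a
composition until `proj_proj` gives the form `proj_node`. -/
theorem proj_node_aux {k n : ℕ} (hkn : k ≤ n) (x : Gam → ℝ) (l : ℕ) (hl : 1 ≤ l) (hln : l < n)
    {r s : ℕ} (hr : r ≤ l) (hs : s ≤ n) (ξ : Delta r) (η : Delta s) (ε ε' : ℤˣ) :
    proj a b k x ⟨n + 1, .node l hl hln hr hs ξ η ε ε'⟩ =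
      ((ε : ℤ) : ℝ) * a * proj a b k x ⟨r, ξ⟩ +
        ((ε' : ℤ) : ℝ) * b * (proj a b k x ⟨s, η⟩ - proj a b l (proj a b k x) ⟨s, η⟩) := by
  have h1 := iMap_eq_jMap a b (hkn.trans n.le_succ) (fun γ => x γ)
    ⟨⟨n + 1, .node l hl hln hr hs ξ η ε ε'⟩, le_rfl⟩
  rw [proj, ← h1, iMap_succ a b hkn, stepMap, dif_neg (by omega)]
  simp only [uMap, iMap_eq_jMap a b hkn, iMap_eq_jMap a b hln.le]
  congr 4
  ext γ
  simp [restr, iMap_eq_jMap a b hkn]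

theorem proj_zero_left (x : Gam → ℝ) : proj a b 0 x = 0 := by
  ext γ
  induction γ using Gam.rank_induction with
  | base =>
    have h1 := iMap_eq_jMap a b (Nat.zero_le 1) (fun γ => x γ) ⟨⟨1, .base⟩, le_rfl⟩
    rw [proj, ← h1, iMap_succ a b le_rfl, stepMap, dif_neg (by omega)]
    simp [uMap]
  | node n l hl hln r s hr hs ξ η ε ε' ih =>
    rw [proj_node_aux (Nat.zero_le n), ih _ (hr.trans hln.le), ih _ hs]
    have : proj a b l (proj a b 0 x) = proj a b l 0 :=
      proj_congr fun γ hγ => ih γ (hγ.trans hln.le)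
    rw [this]
    -- Linearity is not available: `proj_add` and `proj_smul` rest on this lemma. So `P_l 0 = 0` is
    -- proved directly, for `l ≥ 1`.
    have h0 : ∀ γ : Gam, ∀ l : ℕ, proj a b l 0 γ = 0 ∨ l = 0 := by
      intro γ
      induction γ using Gam.rank_induction with
      | base =>
        intro l
        rcases Nat.eq_zero_or_pos l with h | h
        · exact Or.inr h
        · exact Or.inl (proj_apply_of_le _ h)
      | node n l hl hln r s hr hs ξ η ε ε' ih =>
        intro k
        rcases Nat.eq_zero_or_pos k with h | h
        · exact Or.inr h
        refine Or.inl ?_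
        by_cases hk : n + 1 ≤ k
        · exact proj_apply_of_le _ hk
        have hk' : k ≤ n := by omega
        have h2 : ∀ γ : Gam, γ.1 ≤ n → proj a b k 0 γ = 0 := fun γ hγ =>
          (ih γ hγ k).resolve_right (by omega)
        rw [proj_node_aux hk', h2 _ (hr.trans hln.le), h2 _ hs,
          proj_congr (y := 0) fun γ hγ => h2 γ (hγ.trans hln.le),
          (ih _ hs l).resolve_right (by omega)]
        simp
    rw [(h0 _ l).resolve_right (by omega)]
    simp

theorem proj_proj_of_le {k l : ℕ} (h : k ≤ l) (x : Gam → ℝ) :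
    proj a b l (proj a b k x) = proj a b k x := by
  ext γ
  induction γ using Gam.rank_induction with
  | base =>
    rcases Nat.eq_zero_or_pos l with rfl | h1
    · rw [proj_zero_left, Nat.le_zero.mp h, proj_zero_left]
    · exact proj_apply_of_le _ h1
  | node n m hm hmn r s hr hs ξ η ε ε' ih =>
    by_cases hl : n + 1 ≤ l
    · exact proj_apply_of_le _ hl
    have hl' : l ≤ n := by omega
    rw [proj_node_aux hl', proj_node_aux (h.trans hl'), ih _ (hr.trans hmn.le), ih _ hs,
      proj_congr fun γ hγ => ih γ (hγ.trans hmn.le)]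

theorem proj_proj (k l : ℕ) (x : Gam → ℝ) :
    proj a b l (proj a b k x) = proj a b (min l k) x := by
  rcases le_total k l with h | h
  · rw [proj_proj_of_le h, min_eq_right h]
  · rw [min_eq_left h]
    exact proj_congr fun γ hγ => proj_apply_of_le _ (hγ.trans h)

theorem proj_node {k n : ℕ} (hkn : k ≤ n) (x : Gam → ℝ) (l : ℕ) (hl : 1 ≤ l) (hln : l < n)
    {r s : ℕ} (hr : r ≤ l) (hs : s ≤ n) (ξ : Delta r) (η : Delta s) (ε ε' : ℤˣ) :
    proj a b k x ⟨n + 1, .node l hl hln hr hs ξ η ε ε'⟩ =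
      ((ε : ℤ) : ℝ) * a * proj a b k x ⟨r, ξ⟩ +
        ((ε' : ℤ) : ℝ) * b * (proj a b k x ⟨s, η⟩ - proj a b (min l k) x ⟨s, η⟩) := by
  rw [proj_node_aux hkn, proj_proj]

theorem proj_add (k : ℕ) (x y : Gam → ℝ) :
    proj a b k (x + y) = proj a b k x + proj a b k y := by
  ext γ
  induction γ using Gam.rank_induction generalizing k with
  | base =>
    rcases Nat.eq_zero_or_pos k with rfl | h1
    · simp [proj_zero_left]
    · simp [proj_apply_of_le (γ := ⟨1, .base⟩) _ h1]
  | node n m hm hmn r s hr hs ξ η ε ε' ih =>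
    by_cases hl : n + 1 ≤ k
    · simp [proj_apply_of_le (γ := ⟨n + 1, _⟩) _ hl]
    have hl' : k ≤ n := by omega
    simp only [Pi.add_apply, proj_node hl'] at ih ⊢
    rw [ih _ (hr.trans hmn.le), ih _ hs, ih _ hs]
    ring

theorem proj_smul (k : ℕ) (c : ℝ) (x : Gam → ℝ) :
    proj a b k (c • x) = c • proj a b k x := by
  ext γ
  induction γ using Gam.rank_induction generalizing k with
  | base =>
    rcases Nat.eq_zero_or_pos k with rfl | h1
    · simp [proj_zero_left]
    · simp [proj_apply_of_le (γ := ⟨1, .base⟩) _ h1]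
  | node n m hm hmn r s hr hs ξ η ε ε' ih =>
    by_cases hl : n + 1 ≤ k
    · simp [proj_apply_of_le (γ := ⟨n + 1, _⟩) _ hl]
    have hl' : k ≤ n := by omega
    simp only [Pi.smul_apply, smul_eq_mul, proj_node hl'] at ih ⊢
    rw [ih _ (hr.trans hmn.le), ih _ hs, ih _ hs]
    ring

/-! ### Uniform bound for the projections -/

theorem abs_sign (ε : ℤˣ) : |((ε : ℤ) : ℝ)| = 1 := by
  rcases Int.units_eq_one_or ε with rfl | rfl <;> simp

theorem abs_sign_combination_le (ha : 0 ≤ a) (hb : 0 ≤ b) (ε ε' : ℤˣ) (u v : ℝ) :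
    |((ε : ℤ) : ℝ) * a * u + ((ε' : ℤ) : ℝ) * b * v| ≤ a * |u| + b * |v| := by
  refine (abs_add_le _ _).trans_eq ?_
  simp [abs_mul, abs_sign, abs_of_nonneg ha, abs_of_nonneg hb]

namespace ClassY

theorem a_pos (h : ClassY a b) : 0 < a := by
  have := h.2.2.1
  linarith

theorem a_lt_one (h : ClassY a b) : a < 1 := h.2.2.2.1

theorem b_pos (h : ClassY a b) : 0 < b := h.1

theorem b_lt_half (h : ClassY a b) : b < 1 / 2 := h.2.1

end ClassY

/-- The bound `1 / (1 - 2 b)` for the norms of the extension maps `j_k`. -/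
def bound (b : ℝ) : ℝ := 1 / (1 - 2 * b)

theorem ClassY.one_le_bound (h : ClassY a b) : 1 ≤ bound b := by
  have h1 := h.b_pos
  have h2 := h.b_lt_half
  rw [bound, le_div_iff₀ (by linarith)]
  linarith

theorem ClassY.bound_pos (h : ClassY a b) : 0 < bound b := zero_lt_one.trans_le h.one_le_bound

theorem ClassY.bound_eq (h : ClassY a b) : 1 + 2 * b * bound b = bound b := by
  have h2 := h.b_lt_half
  rw [bound]
  have : 1 - 2 * b ≠ 0 := by linarith
  field_simp
  ring

/-- Induction on the rank, for all `k` at once. At a node with cut `m`, if `k ≤ m` the bracket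
vanishes and `a < 1` suffices. If `m ≤ k`, then `ξ ∈ Γ_k`, so `x ξ` is bounded by `M` itself, and
the bracket costs at most `2 b` times the inductive bound; `bound b` is the fixed point of `C = 1 +
2 b C`. -/
theorem abs_proj_le (h : ClassY a b) (k : ℕ) (x : Gam → ℝ) (M : ℝ) (hM : 0 ≤ M)
    (hx : ∀ γ : Gam, γ.1 ≤ k → |x γ| ≤ M) (γ : Gam) : |proj a b k x γ| ≤ bound b * M := by
  have hM' : M ≤ bound b * M := le_mul_of_one_le_left hM h.one_le_bound
  have ha := h.a_pos
  have ha1 := h.a_lt_one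
  have hb := h.b_pos
  induction γ using Gam.rank_induction generalizing k with
  | base =>
    rcases Nat.eq_zero_or_pos k with rfl | h1
    · simpa [proj_zero_left] using hM.trans hM'
    · rw [proj_apply_of_le _ h1]
      exact (hx ⟨1, .base⟩ h1).trans hM'
  | node n m hm hmn r s hr hs ξ η ε ε' ih =>
    by_cases hl : n + 1 ≤ k
    · rw [proj_apply_of_le _ hl]
      exact (hx _ hl).trans hM'
    have hl' : k ≤ n := by omega
    rw [proj_node hl']
    refine (abs_sign_combination_le ha.le hb.le ε ε' _ _).trans ?_
    rcases le_total k m with hkm | hkm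
    · rw [min_eq_right hkm, sub_self, abs_zero]
      have := ih ⟨r, ξ⟩ (hr.trans hmn.le) k hx
      nlinarith [abs_nonneg (proj a b k x ⟨r, ξ⟩)]
    · rw [min_eq_left hkm, proj_apply_of_le (γ := ⟨r, ξ⟩) _ (hr.trans hkm)]
      have h1 := hx ⟨r, ξ⟩ (hr.trans hkm)
      have h2 := ih ⟨s, η⟩ hs k hx
      have h3 := ih ⟨s, η⟩ hs m fun γ hγ => hx γ (hγ.trans hkm)
      have h4 := abs_sub (proj a b k x ⟨s, η⟩) (proj a b m x ⟨s, η⟩)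
      calc a * |x ⟨r, ξ⟩| + b * |proj a b k x ⟨s, η⟩ - proj a b m x ⟨s, η⟩|
          ≤ 1 * M + b * (bound b * M + bound b * M) := by gcongr; linarith
        _ = (1 + 2 * b * bound b) * M := by ring
        _ = bound b * M := by rw [h.bound_eq]

/-! ### Finiteness of `Γ_n` -/

/-- The components of an index of rank `n + 1`. -/
def Delta.code : (n : ℕ) → Delta (n + 1) → Option (Fin n × (Σ r : Fin (n + 1), Delta r) ×
    (Σ r : Fin (n + 1), Delta r) × ℤˣ × ℤˣ)
  | _, .base => none
  | _, .node k _ hkn hr hs ξ η ε ε' =>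
    some (⟨k, hkn⟩, ⟨⟨_, by omega⟩, ξ⟩, ⟨⟨_, by omega⟩, η⟩, ε, ε')

theorem Delta.code_injective (n : ℕ) : Function.Injective (Delta.code n) := by
  intro x y hy
  cases x with
  | base =>
    cases y with
    | base => rfl
    | node => simp [code] at hy
  | node k hk hkn hr hs ξ η ε ε' =>
    cases y with
    | base => simp [code] at hy
    | node k' hk' hkn' hr' hs' ξ' η' ε₁ ε₁' =>
      simp only [code, Option.some.injEq, Prod.mk.injEq, Fin.mk.injEq, Sigma.mk.injEq] at hy
      obtain ⟨rfl, ⟨rfl, h2⟩, ⟨rfl, h3⟩, rfl, rfl⟩ := hy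
      cases h2
      cases h3
      rfl

instance instFiniteDelta (n : ℕ) : Finite (Delta n) := by
  induction n using Nat.strong_induction_on with
  | _ n ih =>
    cases n with
    | zero => exact @Finite.of_subsingleton _ ⟨fun x => nomatch x⟩
    | succ n =>
      have h1 : ∀ r : Fin (n + 1), Finite (Delta r) := fun r => ih r r.2
      exact Finite.of_injective _ (Delta.code_injective n)

theorem finite_rank_le (n : ℕ) : {γ : Gam | γ.1 ≤ n}.Finite := by
  have : {γ : Gam | γ.1 ≤ n} ⊆ ⋃ r ∈ Set.Iic n, Set.range fun δ : Delta r => (⟨r, δ⟩ : Gam) := by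
    rintro ⟨r, δ⟩ h
    exact Set.mem_biUnion h ⟨δ, rfl⟩
  exact ((Set.finite_Iic n).biUnion fun r _ => Set.finite_range _).subset this

/-- The finite set `Γ_n`, as a set of indices in `Γ`. -/
def gamFinset (n : ℕ) : Finset Gam := (finite_rank_le n).toFinset

@[simp]
theorem mem_gamFinset {n : ℕ} {γ : Gam} : γ ∈ gamFinset n ↔ γ.1 ≤ n := by simp [gamFinset]

/-- A family of indices `(n + 3, 1, 1, 1, 1, 1)`, one for each rank at least `3`. -/
def tower (n : ℕ) : Delta (n + 3) :=
  .node 1 le_rfl (by omega) le_rfl (by omega) .base .base 1 1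

instance : Infinite Gam :=
  Infinite.of_injective (fun n : ℕ => (⟨n + 3, tower n⟩ : Gam)) fun m n h => by
    simpa using congrArg Sigma.fst h

/-! ### The projections on `ℓ_∞(Γ)` and on `X` -/

/-- The space `ℓ_∞(Γ)`. -/
abbrev LInf : Type := lp (fun _ : Gam => ℝ) ∞

theorem LInf.abs_apply_le (f : LInf) (γ : Gam) : |f γ| ≤ ‖f‖ :=
  lp.norm_apply_le_norm ENNReal.top_ne_zero f γ

theorem memℓp_infty_of_bound {f : Gam → ℝ} {C : ℝ} (h : ∀ γ, |f γ| ≤ C) :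
    Memℓp (E := fun _ : Gam => ℝ) f ∞ := by
  refine memℓp_infty ⟨C, ?_⟩
  rintro _ ⟨γ, rfl⟩
  exact h γ

/-- A linear map on all functions on `Γ` that is bounded in the supremum norm, as an operator on
`ℓ_∞(Γ)`. -/
def opOfBound (T : (Gam → ℝ) →ₗ[ℝ] (Gam → ℝ)) (C : ℝ) (hC : 0 ≤ C)
    (hT : ∀ (f : LInf) (γ : Gam), |T f γ| ≤ C * ‖f‖) : LInf →L[ℝ] LInf :=
  LinearMap.mkContinuous
    { toFun := fun f => ⟨T f, memℓp_infty_of_bound (hT f)⟩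
      map_add' := fun f g => by
        ext γ
        exact congrFun (T.map_add f g) γ
      map_smul' := fun c f => by
        ext γ
        exact congrFun (T.map_smul c f) γ }
    C fun f => lp.norm_le_of_forall_le (by positivity) (hT f)

/-- The projection `x ↦ j_k (x|Γ_k)` on `ℓ_∞(Γ)`. -/
def projL (h : ClassY a b) (k : ℕ) : LInf →L[ℝ] LInf :=
  opOfBound { toFun := proj a b k, map_add' := proj_add k, map_smul' := proj_smul k } (bound b)
    h.bound_pos.le fun f γ =>
      abs_proj_le h k f ‖f‖ (norm_nonneg f) (fun γ _ => f.abs_apply_le γ) γ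

@[simp]
theorem coe_projL (h : ClassY a b) (k : ℕ) (f : LInf) :
    (projL h k f : Gam → ℝ) = proj a b k f := rfl

theorem projL_apply_of_le (h : ClassY a b) {k : ℕ} (f : LInf) {γ : Gam} (hγ : γ.1 ≤ k) :
    projL h k f γ = f γ := proj_apply_of_le _ hγ

theorem norm_projL_le_of_forall (h : ClassY a b) (k : ℕ) (f : LInf) (M : ℝ) (hM : 0 ≤ M)
    (hf : ∀ γ : Gam, γ.1 ≤ k → |f γ| ≤ M) : ‖projL h k f‖ ≤ bound b * M :=
  lp.norm_le_of_forall_le (mul_nonneg h.bound_pos.le hM) (abs_proj_le h k f M hM hf)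

theorem norm_projL_apply_le (h : ClassY a b) (k : ℕ) (f : LInf) :
    ‖projL h k f‖ ≤ bound b * ‖f‖ :=
  norm_projL_le_of_forall h k f _ (norm_nonneg f) fun γ _ => f.abs_apply_le γ

theorem projL_projL (h : ClassY a b) (k l : ℕ) (f : LInf) :
    projL h l (projL h k f) = projL h (min l k) f := by
  ext γ
  simp [proj_proj]

theorem projL_mem (h : ClassY a b) (k : ℕ) (f : LInf) : projL h k f ∈ space a b := by
  refine Submodule.le_topologicalClosure _ (Submodule.subset_span ?_)
  -- The generators require `n ≥ 1` while `k` may be `0`; `P_{k+1} P_k = P_k` allows the index `k +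
  -- 1`.
  refine ⟨k + 1, by omega, fun γ => projL h k f γ, fun γ => ?_⟩
  have := congrFun (proj_proj_of_le (a := a) (b := b) (Nat.le_succ k) f) γ
  exact this.symm

theorem isClosed_space (a b : ℝ) : IsClosed (space a b : Set LInf) :=
  Submodule.isClosed_topologicalClosure _

instance : CompleteSpace (space a b) := (isClosed_space a b).completeSpace_coe

theorem tendsto_projL (h : ClassY a b) {f : LInf} (hf : f ∈ space a b) :
    Tendsto (fun n => projL h n f) atTop (𝓝 f) := by
  have hspan : ∀ g ∈ Submodule.span ℝ {f : LInf |
      ∃ (n : ℕ) (_ : 1 ≤ n) (x : GamLE n → ℝ), ∀ γ : Gam, f γ = jMap a b n x γ},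
      ∀ᶠ n in atTop, projL h n g = g := by
    intro g hg
    induction hg using Submodule.span_induction with
    | mem g hg =>
      obtain ⟨n, -, x, hx⟩ := hg
      obtain ⟨y, hy⟩ := jMap_eq_proj (a := a) (b := b) n x
      have hg : (g : Gam → ℝ) = proj a b n y := (funext hx).trans hy
      filter_upwards [eventually_ge_atTop n] with m hm
      ext γ
      rw [coe_projL, hg, proj_proj_of_le hm]
    | zero => simp
    | add f g _ _ hf hg =>
      filter_upwards [hf, hg] with n h1 h2
      rw [map_add, h1, h2]
    | smul c f _ hf =>
      filter_upwards [hf] with n h1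
      rw [map_smul, h1]
  have hB := h.bound_pos
  rw [Metric.tendsto_nhds]
  intro ε hε
  obtain ⟨g, hg, hfg⟩ := Metric.mem_closure_iff.mp hf (ε / (bound b + 1)) (by positivity)
  filter_upwards [hspan g hg] with n hn
  rw [dist_eq_norm] at hfg ⊢
  have h1 : projL h n f - f = projL h n (f - g) - (f - g) := by
    rw [map_sub, hn]
    abel
  calc ‖projL h n f - f‖ ≤ bound b * ‖f - g‖ + ‖f - g‖ := by
        rw [h1]
        exact (norm_sub_le _ _).trans (add_le_add_left (norm_projL_apply_le h n _) _)
    _ = (bound b + 1) * ‖f - g‖ := by ring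
    _ < (bound b + 1) * (ε / (bound b + 1)) := by gcongr
    _ = ε := by field_simp

/-- The projection `x ↦ j_k (x|Γ_k)`, as an operator from `ℓ_∞(Γ)` to the Bourgain–Delbaen
space. -/
def toSpace (h : ClassY a b) (k : ℕ) : LInf →L[ℝ] space a b :=
  (projL h k).codRestrict (space a b) (projL_mem h k)

@[simp]
theorem coe_toSpace (h : ClassY a b) (k : ℕ) (f : LInf) :
    (toSpace h k f : LInf) = projL h k f := rfl

theorem norm_toSpace_le (h : ClassY a b) (k : ℕ) (f : LInf) :
    ‖toSpace h k f‖ ≤ bound b * ‖f‖ := norm_projL_apply_le h k f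

theorem tendsto_toSpace (h : ClassY a b) (x : space a b) :
    Tendsto (fun n => toSpace h n x) atTop (𝓝 x) :=
  tendsto_subtype_rng.mpr (tendsto_projL h x.2)

/-- The value at an index, as a functional on the Bourgain–Delbaen space. -/
def eval (a b : ℝ) (γ : Gam) : StrongDual ℝ (space a b) :=
  (lp.evalCLM ℝ (fun _ : Gam => ℝ) ∞ γ) ∘L (space a b).subtypeL

@[simp]
theorem eval_apply (γ : Gam) (x : space a b) : eval a b γ x = (x : LInf) γ := rfl

theorem norm_eval_le (γ : Gam) : ‖eval a b γ‖ ≤ 1 :=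
  ContinuousLinearMap.opNorm_le_bound _ zero_le_one fun x => by
    simpa using LInf.abs_apply_le (x : LInf) γ

open Classical in
theorem proj_eq_sum (k : ℕ) (x : Gam → ℝ) :
    proj a b k x = ∑ γ ∈ gamFinset k, x γ • proj a b k (Pi.single γ 1) := by
  let T : (Gam → ℝ) →ₗ[ℝ] (Gam → ℝ) :=
    { toFun := proj a b k, map_add' := proj_add k, map_smul' := proj_smul k }
  have h1 : proj a b k x = T (∑ γ ∈ gamFinset k, x γ • Pi.single γ 1) := by
    refine proj_congr fun γ hγ => ?_
    rw [Finset.sum_apply, Finset.sum_eq_single γ]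
    · simp
    · intro δ _ hδ
      simp [hδ.symm]
    · intro hγ'
      exact absurd (mem_gamFinset.mpr hγ) hγ'
  rw [h1, map_sum]
  simp [T]

open Classical in
theorem toSpace_eq_sum (h : ClassY a b) (k : ℕ) (f : LInf) :
    toSpace h k f = ∑ γ ∈ gamFinset k, f γ • toSpace h k (lp.single ∞ γ 1) := by
  ext δ
  have h1 := congrFun (proj_eq_sum (a := a) (b := b) k f) δ
  rw [Finset.sum_apply] at h1
  have h2 : (↑(∑ γ ∈ gamFinset k, f γ • toSpace h k (lp.single ∞ γ 1)) : LInf) δ =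
      ∑ γ ∈ gamFinset k, f γ • proj a b k (Pi.single γ 1) δ := by
    have h3 := map_sum (eval a b δ) (fun γ => f γ • toSpace h k (lp.single ∞ γ 1)) (gamFinset k)
    refine h3.trans (Finset.sum_congr rfl fun γ _ => ?_)
    rw [map_smul, eval_apply, coe_toSpace, coe_projL, lp.coeFn_single]
  exact h1.trans h2.symm

/-! ### Symmetries given by sequences of signs -/

/-- The rank preserving symmetry of the set of indices given by a sequence of signs. -/
def Delta.flip (t : ℕ → ℤˣ) : {n : ℕ} → Delta n → Delta n
  | _, .base => .base
  | n + 1, .node (r := r) (s := s) k hk hkn hr hs ξ η ε ε' =>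
    .node k hk hkn hr hs (ξ.flip t) (η.flip t) (t (n + 1) * t r * ε) (t (n + 1) * t s * ε')

/-- The weighted composition operator given by a sequence of signs, on all functions on `Γ`. -/
def signMap (t : ℕ → ℤˣ) : (Gam → ℝ) →ₗ[ℝ] (Gam → ℝ) where
  toFun x γ := ((t γ.1 : ℤ) : ℝ) * x ⟨γ.1, γ.2.flip t⟩
  map_add' x y := by
    ext γ
    simp [mul_add]
  map_smul' c x := by
    ext γ
    simp
    ring

theorem signMap_apply (t : ℕ → ℤˣ) (x : Gam → ℝ) (γ : Gam) :
    signMap t x γ = ((t γ.1 : ℤ) : ℝ) * x ⟨γ.1, γ.2.flip t⟩ := rfl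

theorem sign_mul_self (ε : ℤˣ) : ((ε : ℤ) : ℝ) * ((ε : ℤ) : ℝ) = 1 := by
  rcases Int.units_eq_one_or ε with rfl | rfl <;> simp

/-- At rank `n + 1` the outer factor `t (n + 1)` cancels the one put into the new signs, leaving `t
r * ε` and `t s * ε'`, the factors that `signMap` produces at `ξ` and `η`. Hence `signMap` respects
the recursion. -/
theorem proj_signMap (t : ℕ → ℤˣ) (k : ℕ) (x : Gam → ℝ) :
    proj a b k (signMap t x) = signMap t (proj a b k x) := by
  ext γ
  induction γ using Gam.rank_induction generalizing k with
  | base =>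
    rcases Nat.eq_zero_or_pos k with rfl | h1
    · simp [proj_zero_left]
    · rw [proj_apply_of_le _ h1, signMap_apply, signMap_apply]
      simp [Delta.flip, proj_apply_of_le (γ := ⟨1, .base⟩) _ h1]
  | node n m hm hmn r s hr hs ξ η ε ε' ih =>
    by_cases hl : n + 1 ≤ k
    · rw [proj_apply_of_le _ hl, signMap_apply, signMap_apply, proj_apply_of_le]
      exact hl
    have hl' : k ≤ n := by omega
    rw [proj_node hl', ih _ (hr.trans hmn.le), ih _ hs, ih _ hs]
    simp only [signMap_apply, Delta.flip, proj_node hl', Units.val_mul, Int.cast_mul]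
    linear_combination (-(((t r : ℤ) : ℝ) * ε * a * proj a b k x ⟨r, ξ.flip t⟩) -
      ((t s : ℤ) : ℝ) * ε' * b * (proj a b k x ⟨s, η.flip t⟩ -
        proj a b (min m k) x ⟨s, η.flip t⟩)) * sign_mul_self (t (n + 1))

/-- The weighted composition operator given by a sequence of signs, on `ℓ_∞(Γ)`. -/
def signL (t : ℕ → ℤˣ) : LInf →L[ℝ] LInf :=
  opOfBound (signMap t) 1 zero_le_one fun f γ => by
    rw [signMap_apply, abs_mul, abs_sign]
    gcongr
    exact f.abs_apply_le _

theorem signL_mem (h : ClassY a b) (t : ℕ → ℤˣ) {f : LInf} (hf : f ∈ space a b) :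
    signL t f ∈ space a b := by
  refine (isClosed_space a b).mem_of_tendsto
    (((signL t).continuous.tendsto f).comp (tendsto_projL h hf)) (Eventually.of_forall fun n => ?_)
  have : signL t (projL h n f) = projL h n (signL t f) := by
    ext γ
    exact congrFun (proj_signMap t n f).symm γ
  rw [Function.comp_apply, this]
  exact projL_mem h n _

/-- The weighted composition operator given by a sequence of signs, on the Bourgain–Delbaen
space. -/
def signOp (h : ClassY a b) (t : ℕ → ℤˣ) : space a b →L[ℝ] space a b :=
  ((signL t) ∘L (space a b).subtypeL).codRestrict (space a b) fun x => signL_mem h t x.2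

-- As `t 1 = u 1`, the two flips send the tower index of rank `n + 3` to different indices `δ, δ'`.
-- The vector `P_{n+3} e_δ` is `1` at `δ` and `0` at `δ'`, so the two images of it differ by `1` in
-- absolute value at the tower index.
open Classical in
theorem le_norm_signOp_sub (h : ClassY a b) {t u : ℕ → ℤˣ} (h1 : t 1 = u 1) {n : ℕ}
    (hn : t (n + 3) ≠ u (n + 3)) : (bound b)⁻¹ ≤ ‖signOp h t - signOp h u‖ := by
  have hB := h.bound_pos
  let γ : Gam := ⟨n + 3, tower n⟩
  let δ : Gam := ⟨n + 3, (tower n).flip t⟩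
  let δ' : Gam := ⟨n + 3, (tower n).flip u⟩
  have hne : δ' ≠ δ := by
    intro hδ
    simp only [δ, δ', Sigma.mk.injEq, heq_eq_eq, true_and] at hδ
    have := congrArg (Delta.code (n + 2)) hδ
    simp only [tower, Delta.flip, Delta.code, Option.some.injEq, Prod.mk.injEq, mul_one, h1] at this
    exact hn (mul_right_cancel this.2.2.2.1).symm
  let x : space a b := toSpace h (n + 3) (lp.single ∞ δ 1)
  have hx : ‖x‖ ≤ bound b := by
    refine (norm_toSpace_le h (n + 3) (lp.single ∞ δ 1)).trans_eq ?_
    rw [lp.norm_single ENNReal.zero_lt_top, norm_one, mul_one]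
  have hxδ : (x : LInf) δ = 1 := by
    refine (projL_apply_of_le h (lp.single ∞ δ 1) (γ := δ) le_rfl).trans ?_
    simp
  have hxδ' : (x : LInf) δ' = 0 := by
    refine (projL_apply_of_le h (lp.single ∞ δ 1) (γ := δ') le_rfl).trans ?_
    simp [hne]
  have hval : |((signOp h t - signOp h u) x : LInf) γ| = 1 := by
    have : ((signOp h t - signOp h u) x : LInf) γ =
        ((t (n + 3) : ℤ) : ℝ) * (x : LInf) δ - ((u (n + 3) : ℤ) : ℝ) * (x : LInf) δ' := rfl
    rw [this, hxδ, hxδ', mul_one, mul_zero, sub_zero, abs_sign]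
  rw [inv_le_iff_one_le_mul₀ hB, ← hval]
  refine (LInf.abs_apply_le _ γ).trans ?_
  exact ((signOp h t - signOp h u).le_opNorm x).trans (by gcongr)

theorem countable_of_separated {ι E : Type*} [NormedAddCommGroup E]
    [TopologicalSpace.SeparableSpace E] {T : ι → E} {c : ℝ} (hc : 0 < c)
    (hT : ∀ i j, i ≠ j → c ≤ ‖T i - T j‖) : Countable ι := by
  refine Pairwise.countable_of_isOpen_disjoint (s := fun i => Metric.ball (T i) (c / 2)) ?_
    (fun _ => Metric.isOpen_ball) fun i => ⟨T i, Metric.mem_ball_self (by positivity)⟩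
  intro i j hij
  refine Metric.ball_disjoint_ball ?_
  rw [add_halves, dist_eq_norm]
  exact hT i j hij

/-- The operators on the Bourgain–Delbaen space do not form a separable space. -/
theorem not_separableSpace_operators (h : ClassY a b) :
    ¬ TopologicalSpace.SeparableSpace (space a b →L[ℝ] space a b) := by
  intro hsep
  have hB := h.bound_pos
  -- Only ranks at least `3`, where tower indices exist, carry free signs; this also makes all
  -- sequences agree at rank `1`.
  let T : (ℕ → ℤˣ) → (space a b →L[ℝ] space a b) := fun t =>
    signOp h fun r => if r < 3 then 1 else t (r - 3)
  have hT : ∀ t u : ℕ → ℤˣ, t ≠ u → (bound b)⁻¹ ≤ ‖T t - T u‖ := by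
    intro t u htu
    obtain ⟨n, hn⟩ := Function.ne_iff.mp htu
    exact le_norm_signOp_sub h (by simp) (n := n) (by simpa using hn)
  have hcount := countable_of_separated (T := T) (inv_pos.mpr hB) hT
  obtain ⟨f, hf⟩ := exists_surjective_nat (ℕ → ℤˣ)
  -- Cantor's diagonal argument.
  obtain ⟨n, hn⟩ := hf fun n => -f n n
  have := congrFun hn n
  rcases Int.units_eq_one_or (f n n) with h1 | h1 <;> simp [h1] at this

/-! ### Upper estimate for sums of blocks -/

/-- For `a, b < 1` there is an exponent `q < 1` for which the combination `a u ^ q + b v ^ q` is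
strictly dominated by `(u + v) ^ q`. -/
theorem exists_exponent (ha : 0 < a) (ha1 : a < 1) (hb : 0 < b) (hb1 : b < 1) :
    ∃ q c : ℝ, 0 < q ∧ q < 1 ∧ 0 < c ∧ c < 1 ∧
      ∀ u v : ℝ, 0 ≤ u → 0 ≤ v → a * u ^ q + b * v ^ q ≤ c * (u + v) ^ q := by
  have h1 : Tendsto (fun n : ℕ => a ^ n + b ^ n) atTop (𝓝 (0 + 0)) :=
    (tendsto_pow_atTop_nhds_zero_of_lt_one ha.le ha1).add
      (tendsto_pow_atTop_nhds_zero_of_lt_one hb.le hb1)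
  rw [add_zero] at h1
  -- With `a^n + b^n < 1`, Hölder's inequality for `n` and its conjugate `n'` gives `q = 1/n'` and
  -- `c = (a^n + b^n)^{1/n}`.
  obtain ⟨n, hn, hn2⟩ := ((h1.eventually_lt_const one_pos).and (eventually_ge_atTop 2)).exists
  have hn1 : (1 : ℝ) < n := by exact_mod_cast hn2
  have hpq : (n : ℝ).HolderConjugate (Real.conjExponent n) := .conjExponent hn1
  have hs0 : 0 < a ^ n + b ^ n := by positivity
  refine ⟨(Real.conjExponent n)⁻¹, (a ^ n + b ^ n) ^ ((n : ℝ)⁻¹), inv_pos.mpr hpq.symm.pos,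
    inv_lt_one_of_one_lt₀ hpq.symm.lt, by positivity,
    Real.rpow_lt_one hs0.le hn (inv_pos.mpr hpq.pos), fun u v hu hv => ?_⟩
  have h2 := Real.inner_le_Lp_mul_Lq_of_nonneg (Finset.univ : Finset (Fin 2)) hpq
    (f := ![a, b]) (g := ![u ^ (Real.conjExponent n)⁻¹, v ^ (Real.conjExponent n)⁻¹])
    (fun i _ => by fin_cases i <;> simp [ha.le, hb.le])
    (fun i _ => by fin_cases i <;> simp <;> positivity)
  simpa [Fin.sum_univ_two, Real.rpow_inv_rpow hu hpq.symm.ne_zero,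
    Real.rpow_inv_rpow hv hpq.symm.ne_zero] using h2

theorem abs_sum_ite_le {Q : ℕ → Prop} [DecidablePred Q] (hQ : ∀ k m, Q k → Q m → k = m)
    {z : ℕ → ℝ} {B : ℝ} (hB : 0 ≤ B) (hz : ∀ k, |z k| ≤ B) (F : Finset ℕ) :
    |∑ k ∈ F, if Q k then z k else 0| ≤ B := by
  by_cases h : ∃ k ∈ F, Q k
  · obtain ⟨k, hk, hQk⟩ := h
    rw [Finset.sum_eq_single_of_mem k hk fun m _ hmk => if_neg fun hm => hmk (hQ m k hm hQk),
      if_pos hQk]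
    exact hz k
  · push Not at h
    rw [Finset.sum_eq_zero fun k hk => if_neg (h k hk), abs_zero]
    exact hB

theorem blocks_eq_of_between {p : ℕ → ℕ} (hp : StrictMono p) {c k m : ℕ} (hk : p k ≤ c)
    (hk' : c < p (k + 1)) (hm : p m ≤ c) (hm' : c < p (m + 1)) : k = m := by
  have h1 := hp.lt_iff_lt.mp (hk.trans_lt hm')
  have h2 := hp.lt_iff_lt.mp (hm.trans_lt hk')
  omega

/-- An upper estimate for sums of bounded block sequences. -/
theorem abs_sum_blocks_le (h : ClassY a b) {q c : ℝ} (hq : 0 < q) (hc : c < 1)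
    (hqc : ∀ u v : ℝ, 0 ≤ u → 0 ≤ v → a * u ^ q + b * v ^ q ≤ c * (u + v) ^ q)
    {p : ℕ → ℕ} (hp : StrictMono p) {y : ℕ → Gam → ℝ} {B : ℝ} (hyB : ∀ k γ, |y k γ| ≤ B)
    (hy0 : ∀ k, proj a b (p k) (y k) = 0) (hy1 : ∀ k, proj a b (p (k + 1)) (y k) = y k)
    (γ : Gam) (F : Finset ℕ) :
    |∑ k ∈ F, y k γ| ≤ 2 * B / (1 - c) * (F.card : ℝ) ^ q := by
  have hB : 0 ≤ B := (abs_nonneg _).trans (hyB 0 ⟨1, .base⟩)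
  have ha := h.a_pos
  have hb := h.b_pos
  have hc0 : 0 ≤ c := by
    have := hqc 1 0 zero_le_one le_rfl
    simp [Real.zero_rpow hq.ne'] at this
    linarith
  -- The fixed point of `C = 2B + cC`: each node costs `2B` for at most two exceptional blocks and
  -- contracts the rest by `c`.
  set C := 2 * B / (1 - c) with hC
  have hCeq : 2 * B + c * C = C := by
    rw [hC]
    have : 1 - c ≠ 0 := by linarith
    field_simp
    ring
  have hC0 : 0 ≤ C := div_nonneg (by linarith) (by linarith)
  have hzero : ∀ k (γ : Gam), γ.1 ≤ p k → y k γ = 0 := fun k γ hγ => by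
    rw [← proj_apply_of_le (a := a) (b := b) (y k) hγ, hy0]
    rfl
  have hone : ∀ F : Finset ℕ, F.Nonempty → (1 : ℝ) ≤ (F.card : ℝ) ^ q := fun F hF =>
    Real.one_le_rpow (by exact_mod_cast hF.card_pos) hq.le
  induction γ using Gam.rank_induction generalizing F with
  | base =>
    rcases F.eq_empty_or_nonempty with rfl | hF
    · simp [Real.zero_rpow hq.ne']
    -- For `k ≥ 1`, `p k ≥ k ≥ 1`, so the block vanishes at rank `1`.
    have h1 : ∀ k, y k ⟨1, .base⟩ = if k = 0 then y k ⟨1, .base⟩ else 0 := by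
      intro k
      split_ifs with hk
      · rfl
      · exact hzero k _ ((Nat.one_le_iff_ne_zero.mpr hk).trans hp.le_apply)
    rw [Finset.sum_congr rfl fun k _ => h1 k]
    refine (abs_sum_ite_le (by omega) hB (fun k => hyB k _) F).trans ?_
    have := hone F hF
    nlinarith
  | node n l hl hln r s hr hs ξ η ε ε' ih =>
    rcases F.eq_empty_or_nonempty with rfl | hF
    · simp [Real.zero_rpow hq.ne']
    set γ : Gam := ⟨n + 1, .node l hl hln hr hs ξ η ε ε'⟩
    set F₁ := F.filter fun k => p (k + 1) ≤ l
    set F₂ := F.filter fun k => l ≤ p k ∧ p (k + 1) ≤ n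
    -- A block ending by `l` is fixed by `P_l`, so only `ξ` sees it. A block starting at or after
    -- `l` and ending by `n` is killed by `P_l` and vanishes at `ξ`, so only `η` sees it. At most
    -- one block straddles `l` and at most one further block straddles `n`; blocks beyond `n` vanish
    -- at `γ`.
    have hsplit : ∀ k, y k γ =
        ((ε : ℤ) : ℝ) * a * (if p (k + 1) ≤ l then y k ⟨r, ξ⟩ else 0) +
        ((ε' : ℤ) : ℝ) * b * (if l ≤ p k ∧ p (k + 1) ≤ n then y k ⟨s, η⟩ else 0) +
        ((if p k < l ∧ l < p (k + 1) then y k γ else 0) +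
          (if l ≤ p k ∧ p k ≤ n ∧ n < p (k + 1) then y k γ else 0)) := by
      intro k
      have hk := hp k.lt_succ_self
      rw [Nat.succ_eq_add_one] at hk
      have hnode : p (k + 1) ≤ n → y k γ = ((ε : ℤ) : ℝ) * a * y k ⟨r, ξ⟩ +
          ((ε' : ℤ) : ℝ) * b * (y k ⟨s, η⟩ - proj a b (min l (p (k + 1))) (y k) ⟨s, η⟩) := by
        intro hk'
        have := proj_node hk' (y k) l hl hln hr hs ξ η ε ε' (a := a) (b := b)
        rw [← proj_proj, hy1]
        rwa [hy1, ← proj_proj, hy1] at this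
      by_cases h1 : p (k + 1) ≤ l
      · rw [if_pos h1, if_neg (by omega), if_neg (by omega), if_neg (by omega),
          hnode (by omega), min_eq_right h1, hy1]
        ring
      by_cases h2 : p k < l
      · rw [if_neg h1, if_neg (by omega), if_pos (by omega), if_neg (by omega)]
        ring
      by_cases h3 : p (k + 1) ≤ n
      · have h4 : proj a b (min l (p (k + 1))) (y k) = 0 := by
          rw [min_eq_left (by omega), ← min_eq_left (a := l) (b := p k) (by omega),
            ← proj_proj, hy0]
          have := proj_smul (a := a) (b := b) l 0 0
          simpa using this
        rw [if_neg h1, if_pos (by omega), if_neg (by omega), if_neg (by omega), hnode h3, h4,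
          hzero k ⟨r, ξ⟩ (by simp only; omega)]
        simp
      by_cases h4 : p k ≤ n
      · rw [if_neg h1, if_neg (by omega), if_neg (by omega), if_pos (by omega)]
        ring
      · rw [if_neg h1, if_neg (by omega), if_neg (by omega), if_neg (by omega),
          hzero k γ (by simp only [γ]; omega)]
        ring
    have hsum : ∑ k ∈ F, y k γ =
        ((ε : ℤ) : ℝ) * a * ∑ k ∈ F₁, y k ⟨r, ξ⟩ + ((ε' : ℤ) : ℝ) * b * ∑ k ∈ F₂, y k ⟨s, η⟩ +
        (∑ k ∈ F, (if p k < l ∧ l < p (k + 1) then y k γ else 0) +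
          ∑ k ∈ F, (if l ≤ p k ∧ p k ≤ n ∧ n < p (k + 1) then y k γ else 0)) := by
      rw [Finset.sum_congr rfl fun k _ => hsplit k, Finset.sum_add_distrib,
        Finset.sum_add_distrib, Finset.sum_add_distrib, ← Finset.mul_sum, ← Finset.mul_sum,
        Finset.sum_filter, Finset.sum_filter]
    have he1 := abs_sum_ite_le (Q := fun k => p k < l ∧ l < p (k + 1))
      (fun k m hk hm => blocks_eq_of_between hp hk.1.le hk.2 hm.1.le hm.2) hB
      (fun k => hyB k γ) F
    have he2 := abs_sum_ite_le (Q := fun k => l ≤ p k ∧ p k ≤ n ∧ n < p (k + 1))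
      (fun k m hk hm => blocks_eq_of_between hp hk.2.1 hk.2.2 hm.2.1 hm.2.2) hB
      (fun k => hyB k γ) F
    have hcard : F₁.card + F₂.card ≤ F.card := by
      rw [← Finset.card_union_of_disjoint]
      · exact Finset.card_le_card
          (Finset.union_subset (Finset.filter_subset _ _) (Finset.filter_subset _ _))
      · rw [Finset.disjoint_filter]
        intro k _ h1 h2
        have := hp k.lt_succ_self
        rw [Nat.succ_eq_add_one] at this
        omega
    have hu : (0 : ℝ) ≤ F₁.card := Nat.cast_nonneg _
    have hv : (0 : ℝ) ≤ F₂.card := Nat.cast_nonneg _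
    have hcard' : ((F₁.card : ℝ) + F₂.card) ^ q ≤ (F.card : ℝ) ^ q :=
      Real.rpow_le_rpow (add_nonneg hu hv) (by exact_mod_cast hcard) hq.le
    have i1 := ih ⟨r, ξ⟩ (hr.trans hln.le) F₁
    have i2 := ih ⟨s, η⟩ hs F₂
    rw [hsum]
    calc _ ≤ (a * |∑ k ∈ F₁, y k ⟨r, ξ⟩| + b * |∑ k ∈ F₂, y k ⟨s, η⟩|) + (B + B) :=
          (abs_add_le _ _).trans (add_le_add (abs_sign_combination_le ha.le hb.le _ _ _ _)
            ((abs_add_le _ _).trans (add_le_add he1 he2)))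
      _ ≤ (a * (C * (F₁.card : ℝ) ^ q) + b * (C * (F₂.card : ℝ) ^ q)) + (B + B) := by gcongr
      _ = C * (a * (F₁.card : ℝ) ^ q + b * (F₂.card : ℝ) ^ q) + 2 * B := by ring
      _ ≤ C * (c * ((F₁.card : ℝ) + F₂.card) ^ q) + 2 * B := by
          gcongr
          exact hqc _ _ hu hv
      _ ≤ C * (c * (F.card : ℝ) ^ q) + 2 * B * (F.card : ℝ) ^ q := by
          refine add_le_add (by gcongr) ?_
          exact le_mul_of_one_le_right (by positivity) (hone F hF)
      _ = (2 * B + c * C) * (F.card : ℝ) ^ q := by ring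
      _ = C * (F.card : ℝ) ^ q := by rw [hCeq]

/-! ### The decomposition is shrinking -/

/-- The projections `x ↦ j_n (x|Γ_n)`, as operators on the Bourgain–Delbaen space. -/
def projX (h : ClassY a b) (n : ℕ) : space a b →L[ℝ] space a b :=
  toSpace h n ∘L (space a b).subtypeL

theorem projX_apply (h : ClassY a b) (n : ℕ) (x : space a b) : projX h n x = toSpace h n x := rfl

theorem tendsto_projX (h : ClassY a b) (x : space a b) :
    Tendsto (fun n => projX h n x) atTop (𝓝 x) := tendsto_toSpace h x

theorem norm_projX_apply_le (h : ClassY a b) (n : ℕ) (x : space a b) :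
    ‖projX h n x‖ ≤ bound b * ‖x‖ := norm_toSpace_le h n x

theorem projX_projX (h : ClassY a b) (k l : ℕ) (x : space a b) :
    projX h l (projX h k x) = projX h (min l k) x :=
  Subtype.ext (projL_projL h k l x)

/-- One step of a gliding hump: truncate at `m` a vector on which `f - f ∘ P_n` is large, remove its
first `n` levels, and divide by `±‖x‖`. -/
theorem exists_block {X : Type*} [NormedAddCommGroup X] [NormedSpace ℝ X] {P : ℕ → X →L[ℝ] X}
    {K : ℝ} (hPn : ∀ n x, ‖P n x‖ ≤ K * ‖x‖) (hPP : ∀ k l x, P l (P k x) = P (min l k) x)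
    (hPlim : ∀ x, Tendsto (fun n => P n x) atTop (𝓝 x))
    (f : StrongDual ℝ X) {δ : ℝ} (hδ : 0 < δ) (n : ℕ)
    (hn : δ < ‖f - f ∘L P n‖) :
    ∃ m : ℕ, n < m ∧ ∃ y : X, δ < f y ∧ ‖y‖ ≤ 2 * K ∧ P n y = 0 ∧
      P m y = y := by
  obtain ⟨x, hx⟩ : ∃ x, δ * ‖x‖ < ‖(f - f ∘L P n) x‖ := by
    by_contra! hcon
    exact hn.not_ge (ContinuousLinearMap.opNorm_le_bound _ hδ.le hcon)
  have hx0 : 0 < ‖x‖ := by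
    rw [norm_pos_iff]
    rintro rfl
    simp at hx
  have hlim : Tendsto (fun m => ‖f (P m x - P n x)‖) atTop
      (𝓝 ‖(f - f ∘L P n) x‖) := by
    have h1 : (f - f ∘L P n) x = f (x - P n x) := by simp
    rw [h1]
    exact (f.continuous.norm.tendsto _).comp ((hPlim x).sub_const _)
  obtain ⟨m, hm, hnm⟩ := ((hlim.eventually_const_lt hx).and (eventually_gt_atTop n)).exists
  set z := P m x - P n x with hz
  have hz0 : P n z = 0 := by
    rw [hz, map_sub, hPP, hPP, min_eq_left hnm.le, min_self, sub_self]
  have hz1 : P m z = z := by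
    rw [hz, map_sub, hPP, hPP, min_eq_right hnm.le, min_self]
  have hzn : ‖z‖ ≤ 2 * K * ‖x‖ := by
    refine (norm_sub_le _ _).trans ?_
    linarith [hPn m x, hPn n x]
  have hmain : ∀ c : ℝ, |c| = ‖x‖⁻¹ → δ < c * f z → ∃ y : X, δ < f y ∧
      ‖y‖ ≤ 2 * K ∧ P n y = 0 ∧ P m y = y := by
    intro c hc hcz
    refine ⟨c • z, by simpa using hcz, ?_, by rw [map_smul, hz0, smul_zero],
      by rw [map_smul, hz1]⟩
    rw [norm_smul, Real.norm_eq_abs, hc, inv_mul_le_iff₀ hx0]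
    linarith
  refine ⟨m, hnm, ?_⟩
  have h3 : δ < ‖x‖⁻¹ * |f z| := by
    rw [lt_inv_mul_iff₀ hx0, mul_comm]
    exact hm
  rcases le_total 0 (f z) with h2 | h2
  · exact hmain ‖x‖⁻¹ (abs_of_pos (by positivity)) (by rwa [abs_of_nonneg h2] at h3)
  · refine hmain (-‖x‖⁻¹) (by rw [abs_neg]; exact abs_of_pos (by positivity)) ?_
    rw [abs_of_nonpos h2] at h3
    linarith

/-- If sums of bounded block sequences satisfy an upper `q`-estimate with `q < 1`, then the
decomposition is shrinking. -/
theorem exists_norm_sub_comp_le {X : Type*} [NormedAddCommGroup X] [NormedSpace ℝ X] {P : ℕ → X →L[ℝ] X}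
    {K : ℝ} (hPn : ∀ n x, ‖P n x‖ ≤ K * ‖x‖) (hPP : ∀ k l x, P l (P k x) = P (min l k) x)
    (hPlim : ∀ x, Tendsto (fun n => P n x) atTop (𝓝 x))
    (f : StrongDual ℝ X) {q C : ℝ} (hq1 : q < 1)
    (hup : ∀ (p : ℕ → ℕ) (y : ℕ → X), StrictMono p → (∀ k, ‖y k‖ ≤ 2 * K) →
      (∀ k, P (p k) (y k) = 0) → (∀ k, P (p (k + 1)) (y k) = y k) →
      ∀ N : ℕ, ‖∑ k ∈ Finset.range N, y k‖ ≤ C * (N : ℝ) ^ q)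
    {δ : ℝ} (hδ : 0 < δ) : ∃ n, ‖f - f ∘L P n‖ ≤ δ := by
  by_contra! hcon
  choose m hm y hfy hyB hy0 hy1 using fun n => exists_block hPn hPP hPlim f hδ n (hcon n)
  let p : ℕ → ℕ := fun k => m^[k] 0
  have hps : ∀ k, p (k + 1) = m (p k) := fun k => Function.iterate_succ_apply' m k 0
  have hp : StrictMono p := strictMono_nat_of_lt_succ fun k => by
    rw [hps]
    exact hm _
  have hsum := hup p (fun k => y (p k)) hp (fun k => hyB _) (fun k => hy0 _) fun k => by
    rw [hps]
    exact hy1 _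
  -- Testing `f` on the sum of `N` humps gives growth at least linear in `N`, against `N^q` with `q
  -- < 1`.
  have hlow : ∀ N : ℕ, δ * N ≤ ‖f‖ * (C * (N : ℝ) ^ q) := by
    intro N
    calc δ * N = ∑ k ∈ Finset.range N, δ := by simp [mul_comm]
      _ ≤ ∑ k ∈ Finset.range N, f (y (p k)) := Finset.sum_le_sum fun k _ => (hfy (p k)).le
      _ = f (∑ k ∈ Finset.range N, y (p k)) := (map_sum f _ _).symm
      _ ≤ ‖f‖ * ‖∑ k ∈ Finset.range N, y (p k)‖ := (le_abs_self _).trans (f.le_opNorm _)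
      _ ≤ ‖f‖ * (C * (N : ℝ) ^ q) := by
        gcongr
        exact hsum N
  have htop : Tendsto (fun N : ℕ => δ * (N : ℝ) ^ (1 - q)) atTop atTop :=
    ((tendsto_rpow_atTop (by linarith)).comp tendsto_natCast_atTop_atTop).const_mul_atTop hδ
  obtain ⟨N, hN, hN1⟩ := ((htop.eventually_gt_atTop (‖f‖ * C)).and (eventually_ge_atTop 1)).exists
  have hN0 : (0 : ℝ) < N := by exact_mod_cast hN1
  have h1 : (N : ℝ) ^ (1 - q) * (N : ℝ) ^ q = N := by
    rw [← Real.rpow_add hN0]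
    simp
  have h2 := hlow N
  have h3 : ‖f‖ * C * (N : ℝ) ^ q < δ * (N : ℝ) ^ (1 - q) * (N : ℝ) ^ q := by gcongr
  rw [mul_assoc δ, h1] at h3
  linarith

theorem tendsto_comp_of_upper_estimate {X : Type*} [NormedAddCommGroup X] [NormedSpace ℝ X] {P : ℕ → X →L[ℝ] X}
    {K : ℝ} (hPn : ∀ n x, ‖P n x‖ ≤ K * ‖x‖) (hPP : ∀ k l x, P l (P k x) = P (min l k) x)
    (hPlim : ∀ x, Tendsto (fun n => P n x) atTop (𝓝 x))
    (hK : 0 ≤ K) (f : StrongDual ℝ X) {q C : ℝ} (hq1 : q < 1)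
    (hup : ∀ (p : ℕ → ℕ) (y : ℕ → X), StrictMono p → (∀ k, ‖y k‖ ≤ 2 * K) →
      (∀ k, P (p k) (y k) = 0) → (∀ k, P (p (k + 1)) (y k) = y k) →
      ∀ N : ℕ, ‖∑ k ∈ Finset.range N, y k‖ ≤ C * (N : ℝ) ^ q) :
    Tendsto (fun n => f ∘L P n) atTop (𝓝 f) := by
  
  rw [Metric.tendsto_atTop]
  intro ε hε
  obtain ⟨n, hn⟩ := exists_norm_sub_comp_le hPn hPP hPlim f hq1 hup
    (δ := ε / (2 * (1 + K))) (by positivity)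
  refine ⟨n, fun m hm => ?_⟩
  rw [dist_comm, dist_eq_norm]
  refine lt_of_le_of_lt (b := ε / 2) ?_ (by linarith)
  refine ContinuousLinearMap.opNorm_le_bound _ (by positivity) fun x => ?_
  -- One good `n` controls every `m ≥ n`, since `P_n P_m = P_n`.
  have h1 : (f - f ∘L P m) x = (f - f ∘L P n) (x - P m x) := by
    simp [hPP, min_eq_left hm]
  have h2 : ‖x - P m x‖ ≤ (1 + K) * ‖x‖ := by
    refine (norm_sub_le _ _).trans ?_
    linarith [hPn m x]
  rw [h1]
  calc _ ≤ ‖f - f ∘L P n‖ * ‖x - P m x‖ := ContinuousLinearMap.le_opNorm _ _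
    _ ≤ ε / (2 * (1 + K)) * ((1 + K) * ‖x‖) := by gcongr
    _ = ε / 2 * ‖x‖ := by field_simp

/-- The finite-dimensional decomposition of the Bourgain–Delbaen space is shrinking. -/
theorem tendsto_comp_projX (h : ClassY a b) (f : StrongDual ℝ (space a b)) :
    Tendsto (fun n => f ∘L projX h n) atTop (𝓝 f) := by
  obtain ⟨q, c, hq, hq1, -, hc, hqc⟩ :=
    exists_exponent h.a_pos h.a_lt_one h.b_pos (by linarith [h.b_lt_half])
  refine tendsto_comp_of_upper_estimate (norm_projX_apply_le h) (projX_projX h) (tendsto_projX h)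
    h.bound_pos.le f hq1 (C := 2 * (2 * bound b) / (1 - c)) ?_
  intro p y hp hyB hy0 hy1 N
  have hC0 : 0 ≤ 2 * (2 * bound b) / (1 - c) :=
    div_nonneg (by linarith [h.bound_pos]) (by linarith)
  refine lp.norm_le_of_forall_le (by positivity) fun γ => ?_
  have h1 : ((∑ k ∈ Finset.range N, y k : space a b) : LInf) γ =
      ∑ k ∈ Finset.range N, (y k : LInf) γ := map_sum (eval a b γ) y (Finset.range N)
  have h2 := abs_sum_blocks_le h hq hc hqc hp (y := fun k => (y k : LInf)) (B := 2 * bound b)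
    (fun k γ => (LInf.abs_apply_le _ γ).trans (hyB k))
    (fun k => congrArg (fun z : space a b => ((z : LInf) : Gam → ℝ)) (hy0 k))
    (fun k => congrArg (fun z : space a b => ((z : LInf) : Gam → ℝ)) (hy1 k))
    γ (Finset.range N)
  rw [Finset.card_range] at h2
  exact (congrArg abs h1).trans_le h2

/-! ### Spaces spanned by an `ℓ_1`-sequence -/

theorem lp_one_summable_abs (α : lp (fun _ : ℕ => ℝ) 1) : Summable fun i => |α i| := by
  simpa using (lp.memℓp α).summable (by simp)

theorem lp_one_norm_eq (α : lp (fun _ : ℕ => ℝ) 1) : ‖α‖ = ∑' i, |α i| := by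
  simp [lp.norm_eq_tsum_rpow (p := 1) (by simp) α]

theorem summable_smul_of_lp_one {Y : Type*} [NormedAddCommGroup Y] [NormedSpace ℝ Y]
    [CompleteSpace Y] {e : ℕ → Y} (he : ∀ i, ‖e i‖ ≤ 1) (α : lp (fun _ : ℕ => ℝ) 1) :
    Summable fun i => α i • e i :=
  Summable.of_norm_bounded (lp_one_summable_abs α) fun i => by
    rw [norm_smul, Real.norm_eq_abs]
    exact mul_le_of_le_one_right (abs_nonneg _) (he i)

/-- The operator `α ↦ ∑ α_i e_i` from `ℓ_1` given by a sequence in the unit ball. -/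
def sumOp {Y : Type*} [NormedAddCommGroup Y] [NormedSpace ℝ Y] [CompleteSpace Y] (e : ℕ → Y)
    (he : ∀ i, ‖e i‖ ≤ 1) : lp (fun _ : ℕ => ℝ) 1 →L[ℝ] Y :=
  LinearMap.mkContinuous
    { toFun := fun α => ∑' i, α i • e i
      map_add' := fun α β => by
        rw [← (summable_smul_of_lp_one he α).tsum_add (summable_smul_of_lp_one he β)]
        exact tsum_congr fun i => add_smul _ _ _
      map_smul' := fun c α => by
        rw [RingHom.id_apply, ← (summable_smul_of_lp_one he α).tsum_const_smul]
        exact tsum_congr fun i => mul_smul _ _ _ }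
    1 fun α => by
      rw [one_mul, lp_one_norm_eq]
      refine tsum_of_norm_bounded (lp_one_summable_abs α).hasSum fun i => ?_
      rw [norm_smul, Real.norm_eq_abs]
      exact mul_le_of_le_one_right (abs_nonneg _) (he i)

theorem hasSum_sumOp {Y : Type*} [NormedAddCommGroup Y] [NormedSpace ℝ Y] [CompleteSpace Y]
    {e : ℕ → Y} (he : ∀ i, ‖e i‖ ≤ 1) (α : lp (fun _ : ℕ => ℝ) 1) :
    HasSum (fun i => α i • e i) (sumOp e he α) :=
  (summable_smul_of_lp_one he α).hasSum

/-- A Banach space spanned by a sequence equivalent to the unit vector basis of `ℓ_1` is isomorphic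
to `ℓ_1`. -/
theorem nonempty_equiv_lp_one {Y : Type*} [NormedAddCommGroup Y] [NormedSpace ℝ Y]
    [CompleteSpace Y] {e : ℕ → Y} (he : ∀ i, ‖e i‖ ≤ 1) {c : ℝ} (hc : 0 ≤ c)
    (hlow : ∀ (F : Finset ℕ) (α : ℕ → ℝ), ∑ i ∈ F, |α i| ≤ c * ‖∑ i ∈ F, α i • e i‖)
    (hdense : ∀ y : Y, y ∈ closure (Submodule.span ℝ (Set.range e) : Set Y)) :
    Nonempty (Y ≃L[ℝ] lp (fun _ : ℕ => ℝ) 1) := by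
  have hbelow : ∀ α, ‖α‖ ≤ c * ‖sumOp e he α‖ := fun α => by
    rw [lp_one_norm_eq]
    exact le_of_tendsto_of_tendsto' (lp_one_summable_abs α).hasSum
      ((hasSum_sumOp he α).norm.const_mul c) fun F => hlow F α
  have hanti : AntilipschitzWith c.toNNReal (sumOp e he) :=
    AddMonoidHomClass.antilipschitz_of_bound _ fun α => by
      rw [Real.coe_toNNReal c hc]
      exact hbelow α
  have hspan : Submodule.span ℝ (Set.range e) ≤ (sumOp e he).range := by
    rw [Submodule.span_le]
    rintro _ ⟨i, rfl⟩
    refine ⟨lp.single 1 i 1, ?_⟩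
    refine (hasSum_sumOp he _).unique ?_
    have h1 := hasSum_single (f := fun j => (lp.single 1 i (1 : ℝ) : lp (fun _ : ℕ => ℝ) 1) j • e j)
      i fun j hj => by simp [hj]
    simpa using h1
  -- An operator bounded below has closed range; this range is also dense.
  have hclosed : IsClosed (Set.range (sumOp e he)) :=
    hanti.isClosed_range (sumOp e he).uniformContinuous
  have hsurj : Function.Surjective (sumOp e he) := fun y =>
    closure_minimal (fun z hz => hspan hz) hclosed (hdense y)
  exact ⟨(ContinuousLinearEquiv.ofBijective (sumOp e he) (LinearMap.ker_eq_bot.mpr hanti.injective)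
    (LinearMap.range_eq_top.mpr hsurj)).symm⟩

/-! ### Separability of the space of scalar plus compact operators -/

/-- A bounded sequence converging pointwise converges uniformly on compact sets, here on one
containing the image of the unit ball. -/
theorem tendsto_comp_of_isCompactOperator {X : Type*} [NormedAddCommGroup X] [NormedSpace ℝ X]
    {P : ℕ → X →L[ℝ] X} {K : ℝ} (hPn : ∀ n x, ‖P n x‖ ≤ K * ‖x‖)
    (hPlim : ∀ x, Tendsto (fun n => P n x) atTop (𝓝 x)) {T : X →L[ℝ] X}
    (hT : IsCompactOperator T) : Tendsto (fun n => P n ∘L T) atTop (𝓝 T) := by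
  obtain ⟨S, hS, hTS⟩ := hT.image_closedBall_subset_compact 1
  rw [Metric.tendsto_atTop]
  intro ε hε
  have hK : 0 < |K| + 2 := by positivity
  set ε' := ε / 2 / (|K| + 2) with hε'
  have hε'0 : 0 < ε' := by positivity
  obtain ⟨t, ht, hSt⟩ := Metric.totallyBounded_iff.mp hS.totallyBounded ε' hε'0
  have hev : ∀ᶠ n in atTop, ∀ y ∈ t, ‖P n y - y‖ < ε' := by
    rw [eventually_all_finite ht]
    intro y _
    have := (hPlim y).sub_const y
    rw [sub_self] at this
    simpa using (this.norm.eventually_lt_const (by simpa using hε'0))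
  obtain ⟨N, hN⟩ := eventually_atTop.mp hev
  refine ⟨N, fun n hn => ?_⟩
  rw [dist_eq_norm]
  refine lt_of_le_of_lt (b := ε / 2) ?_ (by linarith)
  refine ContinuousLinearMap.opNorm_le_of_unit_norm (by positivity) fun x hx => ?_
  obtain ⟨y, hy, hxy⟩ := Set.mem_iUnion₂.mp (hSt (hTS ⟨x, by simp [hx], rfl⟩))
  rw [Metric.mem_ball, dist_eq_norm] at hxy
  have h1 : (P n ∘L T - T) x = P n (T x - y) + (P n y - y) - (T x - y) := by
    simp
  rw [h1]
  have h2 : ‖P n (T x - y)‖ ≤ |K| * ε' := (hPn n _).trans (by gcongr; exacts [le_abs_self K, hxy.le])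
  calc _ ≤ ‖P n (T x - y)‖ + ‖P n y - y‖ + ‖T x - y‖ :=
        (norm_sub_le _ _).trans (by gcongr; exact norm_add_le _ _)
    _ ≤ |K| * ε' + ε' + ε' := add_le_add (add_le_add h2 (hN n hn y hy).le) hxy.le
    _ = (|K| + 2) * ε' := by ring
    _ = ε / 2 := by
        rw [hε']
        field_simp

/-- If a Banach space has a separable dual and a uniformly bounded sequence of finite rank operators
converging pointwise to the identity, then the scalar plus compact operators form a separable
set. -/
theorem isSeparable_scalarPlusCompact {X ι : Type*} [NormedAddCommGroup X] [NormedSpace ℝ X]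
    [TopologicalSpace.SeparableSpace (StrongDual ℝ X)]
    {P : ℕ → X →L[ℝ] X} {K : ℝ} (hPn : ∀ n x, ‖P n x‖ ≤ K * ‖x‖)
    (hPlim : ∀ x, Tendsto (fun n => P n x) atTop (𝓝 x)) (s : ℕ → Finset ι)
    (φ : ι → StrongDual ℝ X) (v : ℕ → ι → X) (hP : ∀ n x, P n x = ∑ i ∈ s n, φ i x • v n i) :
    TopologicalSpace.IsSeparable (scalarPlusCompact X) := by
  -- `Φ n` parametrizes operators `c I + ∑ ψ_i ⊗ v_i` continuously by a separable space. It reaches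
  -- `c I + P_n T` through `ψ_i = φ_i ∘ T`.
  let Φ : (n : ℕ) → ℝ × (s n → StrongDual ℝ X) → (X →L[ℝ] X) := fun n z =>
    z.1 • ContinuousLinearMap.id ℝ X +
      ∑ i : s n, ContinuousLinearMap.smulRightL ℝ X X (z.2 i) (v n i)
  have hΦ : ∀ n, Continuous (Φ n) := fun n => by
    refine (continuous_fst.smul continuous_const).add (continuous_finsetSum _ fun i _ => ?_)
    exact (((ContinuousLinearMap.smulRightL ℝ X X).continuous.comp
      ((continuous_apply i).comp continuous_snd))).clm_apply continuous_const
  have hsep : TopologicalSpace.IsSeparable (closure (⋃ n, Set.range (Φ n))) :=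
    (TopologicalSpace.IsSeparable.iUnion fun n =>
      TopologicalSpace.isSeparable_range (hΦ n)).closure
  refine hsep.mono ?_
  rintro _ ⟨c, T, hT, rfl⟩
  refine mem_closure_of_tendsto
    ((tendsto_comp_of_isCompactOperator hPn hPlim hT).const_add (c • ContinuousLinearMap.id ℝ X))
    (Eventually.of_forall fun n => Set.mem_iUnion.mpr ⟨n, (c, fun i => φ i ∘L T), ?_⟩)
  ext x
  simp only [Φ, _root_.add_apply, _root_.sum_apply,
    ContinuousLinearMap.comp_apply, hP]
  congr 1
  exact Finset.sum_coe_sort (s n) fun i => φ i (T x) • v n i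

/-! ### The dual of the Bourgain–Delbaen space -/

open Classical in
theorem comp_projX_eq_sum (h : ClassY a b) (f : StrongDual ℝ (space a b)) (n : ℕ) :
    f ∘L projX h n =
      ∑ γ ∈ gamFinset n, f (toSpace h n (lp.single ∞ γ 1)) • eval a b γ := by
  refine ContinuousLinearMap.ext fun x => ?_
  have h1 : f (projX h n x) =
      ∑ γ ∈ gamFinset n, f ((x : LInf) γ • toSpace h n (lp.single ∞ γ 1)) := by
    rw [projX_apply, toSpace_eq_sum, map_sum]
  rw [ContinuousLinearMap.comp_apply, h1, _root_.sum_apply]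
  refine Finset.sum_congr rfl fun γ _ => ?_
  rw [map_smul, smul_eq_mul, mul_comm]
  rfl

theorem mem_closure_span_eval (h : ClassY a b) (f : StrongDual ℝ (space a b)) :
    f ∈ closure (Submodule.span ℝ (Set.range (eval a b)) : Set (StrongDual ℝ (space a b))) := by
  classical
  refine mem_closure_of_tendsto (tendsto_comp_projX h f) (Eventually.of_forall fun n => ?_)
  rw [comp_projX_eq_sum]
  exact Submodule.sum_mem _ fun γ _ => Submodule.smul_mem _ _ (Submodule.subset_span ⟨γ, rfl⟩)

theorem separableSpace_dual (h : ClassY a b) :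
    TopologicalSpace.SeparableSpace (StrongDual ℝ (space a b)) := by
  rw [← TopologicalSpace.isSeparable_univ_iff]
  refine ((Set.countable_range (eval a b)).isSeparable.span (R := ℝ)).closure.mono fun f _ => ?_
  exact mem_closure_span_eval h f

/-- Test on `P_n v`, where `v` carries the signs of the coefficients and `Γ_n` contains all indices
involved: it keeps these signs on `Γ_n` and has norm at most `bound b`. -/
theorem sum_abs_le_norm_sum_eval (h : ClassY a b) (g : ℕ ≃ Gam) (F : Finset ℕ) (α : ℕ → ℝ) :
    ∑ i ∈ F, |α i| ≤ bound b * ‖∑ i ∈ F, α i • eval a b (g i)‖ := by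
  let n := F.sup fun i => (g i).1
  let v : LInf := ⟨fun γ => SignType.sign (α (g.symm γ)), memℓp_infty_of_bound (C := 1) fun γ => by
    cases SignType.sign (α (g.symm γ)) <;> simp⟩
  have hv : ∀ γ, |v γ| ≤ 1 := fun γ => by
    change |((SignType.sign (α (g.symm γ)) : SignType) : ℝ)| ≤ 1
    cases SignType.sign (α (g.symm γ)) <;> simp
  have hx : ‖toSpace h n v‖ ≤ bound b * 1 :=
    norm_projL_le_of_forall h n v 1 zero_le_one fun γ _ => hv γ
  have hval : (∑ i ∈ F, α i • eval a b (g i)) (toSpace h n v) = ∑ i ∈ F, |α i| := by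
    rw [_root_.sum_apply]
    refine Finset.sum_congr rfl fun i hi => ?_
    have h1 : eval a b (g i) (toSpace h n v) = SignType.sign (α i) := by
      have h2 : v (g i) = SignType.sign (α i) := by
        change ((SignType.sign (α (g.symm (g i))) : SignType) : ℝ) = _
        rw [g.symm_apply_apply]
      rw [← h2]
      exact projL_apply_of_le h v (Finset.le_sup (f := fun i => (g i).1) hi)
    rw [_root_.smul_apply, h1, smul_eq_mul, self_mul_sign]
  rw [← hval, mul_comm]
  refine (le_abs_self _).trans (((∑ i ∈ F, α i • eval a b (g i)).le_opNorm _).trans ?_)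
  rw [mul_one] at hx
  gcongr

/-- The dual of the Bourgain–Delbaen space is isomorphic to `ℓ_1`. -/
theorem nonempty_dual_equiv_lp_one (h : ClassY a b) :
    Nonempty (StrongDual ℝ (space a b) ≃L[ℝ] lp (fun _ : ℕ => ℝ) 1) := by
  obtain ⟨g⟩ := nonempty_equiv_of_countable (α := ℕ) (β := Gam)
  refine nonempty_equiv_lp_one (e := fun i => eval a b (g i)) (fun i => norm_eval_le _)
    h.bound_pos.le (sum_abs_le_norm_sum_eval h g) fun f => ?_
  have h1 : Set.range (fun i => eval a b (g i)) = Set.range (eval a b) :=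
    g.surjective.range_comp (eval a b)
  rw [h1]
  exact mem_closure_span_eval h f

theorem isSeparable_scalarPlusCompact_space (h : ClassY a b) :
    TopologicalSpace.IsSeparable (scalarPlusCompact (space a b)) := by
  classical
  have := separableSpace_dual h
  exact isSeparable_scalarPlusCompact (norm_projX_apply_le h) (tendsto_projX h) gamFinset
    (eval a b) (fun n γ => toSpace h n (lp.single ∞ γ 1)) fun n x => toSpace_eq_sum h n x

/-! ### The Schauder basis -/

/-- The indices can be enumerated with nondecreasing rank. -/
theorem exists_enumeration : ∃ g : ℕ ≃ Gam, Monotone fun i => (g i).1 := by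
  classical
  obtain ⟨e⟩ := nonempty_equiv_of_countable (α := Gam) (β := ℕ)
  -- Each rank `r` gets its own interval of integers, of length `M r + 1`, so `φ` orders indices by
  -- rank and then by `e`.
  let M : ℕ → ℕ := fun r => (gamFinset r).sup e
  let B : ℕ → ℕ := fun n => ∑ r ∈ Finset.range n, (M r + 1)
  have hB : Monotone B := fun m n hmn =>
    Finset.sum_le_sum_of_subset (Finset.range_mono hmn)
  let φ : Gam → ℕ := fun γ => B γ.1 + e γ
  have hφ : ∀ γ δ : Gam, γ.1 < δ.1 → φ γ < φ δ := fun γ δ hγδ => by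
    have h1 : e γ ≤ M γ.1 := Finset.le_sup (f := e) (mem_gamFinset.mpr le_rfl)
    have h2 : B (γ.1 + 1) ≤ B δ.1 := hB hγδ
    have h3 : B (γ.1 + 1) = B γ.1 + (M γ.1 + 1) := Finset.sum_range_succ _ _
    simp only [φ]
    omega
  have hinj : Function.Injective φ := fun γ δ hγδ => by
    rcases lt_trichotomy γ.1 δ.1 with h | h | h
    · exact absurd hγδ (hφ γ δ h).ne
    · simp only [φ, h, add_right_inj] at hγδ
      exact e.injective hγδ
    · exact absurd hγδ (hφ δ γ h).ne'
  have : Infinite (Set.range φ) := (Set.infinite_range_of_injective hinj).to_subtype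
  let o := Nat.Subtype.orderIsoOfNat (Set.range φ)
  let k := Equiv.ofInjective φ hinj
  refine ⟨o.toEquiv.trans k.symm, fun i j hij => ?_⟩
  by_contra! hlt
  have h1 := hφ _ _ hlt
  have h2 : ∀ i, φ (k.symm (o i)) = o i := fun i => congrArg Subtype.val (k.apply_symm_apply (o i))
  have h3 : (o i : ℕ) ≤ o j := o.monotone hij
  simp only [Equiv.trans_apply, RelIso.coe_fn_toEquiv] at h1
  rw [h2, h2] at h1
  omega

open Classical in
/-- The vector `j_n (e_γ)`, for an index `γ` of rank `n`. -/
def basisVec (h : ClassY a b) (γ : Gam) : space a b := toSpace h γ.1 (lp.single ∞ γ 1)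

/-- The functional `x ↦ x γ - (j_{n-1} (x|Γ_{n-1})) γ`, for an index `γ` of rank `n`. -/
def basisCoord (h : ClassY a b) (γ : Gam) : StrongDual ℝ (space a b) :=
  eval a b γ - eval a b γ ∘L projX h (γ.1 - 1)

theorem basisCoord_apply (h : ClassY a b) (γ : Gam) (x : space a b) :
    basisCoord h γ x = (x : LInf) γ - (projX h (γ.1 - 1) x : LInf) γ := rfl

theorem projX_basisVec_of_le (h : ClassY a b) {γ : Gam} {m : ℕ} (hm : γ.1 ≤ m) :
    projX h m (basisVec h γ) = basisVec h γ := by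
  refine Subtype.ext ((projL_projL h γ.1 m _).trans ?_)
  rw [min_eq_right hm]
  rfl

theorem projX_basisVec_of_lt (h : ClassY a b) {γ : Gam} {m : ℕ} (hm : m < γ.1) :
    projX h m (basisVec h γ) = 0 := by
  classical
  refine Subtype.ext ((projL_projL h γ.1 m _).trans ?_)
  rw [min_eq_left hm.le]
  refine norm_le_zero_iff.mp ((norm_projL_le_of_forall h m _ 0 le_rfl fun δ hδ => ?_).trans_eq
    (mul_zero _))
  have : δ ≠ γ := by
    rintro rfl
    omega
  simp [this]

open Classical in
theorem basisVec_apply_of_le (h : ClassY a b) {γ δ : Gam} (hδ : δ.1 ≤ γ.1) :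
    (basisVec h γ : LInf) δ = if δ = γ then 1 else 0 := by
  refine (projL_apply_of_le h _ hδ).trans ?_
  split_ifs with h1
  · subst h1
    simp
  · simp [h1]

open Classical in
theorem basisCoord_basisVec (h : ClassY a b) (γ δ : Gam) :
    basisCoord h γ (basisVec h δ) = if γ = δ then 1 else 0 := by
  have h1 := γ.one_le_rank
  rw [basisCoord_apply]
  rcases le_or_gt γ.1 δ.1 with hle | hlt
  · rw [projX_basisVec_of_lt h (by omega), basisVec_apply_of_le h hle]
    exact sub_zero _
  · rw [projX_basisVec_of_le h (by omega), sub_self, if_neg]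
    rintro rfl
    omega

open Classical in
theorem sum_basisCoord_eq (h : ClassY a b) (m : ℕ) (x : space a b) (A : Finset Gam)
    (hA : ∀ γ ∈ A, γ.1 = m + 1) :
    ∑ γ ∈ A, basisCoord h γ x • basisVec h γ =
      toSpace h (m + 1) (∑ γ ∈ A, ((x - projX h m x : space a b) : LInf) γ • lp.single ∞ γ 1) := by
  refine Eq.trans (Finset.sum_congr rfl fun γ hγ => ?_) (map_sum (toSpace h (m + 1))
    (fun γ => ((x - projX h m x : space a b) : LInf) γ • lp.single ∞ γ 1) A).symm
  rw [map_smul, basisVec, basisCoord_apply, hA γ hγ]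
  rfl

theorem sum_smul_single_apply [DecidableEq Gam] (A : Finset Gam) (x : LInf) (δ : Gam) :
    (∑ γ ∈ A, x γ • lp.single ∞ γ 1 : LInf) δ = if δ ∈ A then x δ else 0 := by
  have h1 := map_sum (lp.evalCLM ℝ (fun _ : Gam => ℝ) ∞ δ) (fun γ => x γ • lp.single ∞ γ 1) A
  refine h1.trans ?_
  have h2 : ∀ γ ∈ A, lp.evalCLM ℝ (fun _ : Gam => ℝ) ∞ δ (x γ • lp.single ∞ γ 1) =
      if δ = γ then x δ else 0 := fun γ _ => by
    change x γ * (lp.single ∞ γ (1 : ℝ) : LInf) δ = _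
    split_ifs with h3
    · subst h3
      simp
    · simp [h3]
  rw [Finset.sum_congr rfl h2, Finset.sum_ite_eq]

/-- Within one rank the sum is `P_{m+1}` of the coordinates of `x - P_m x` cut down to `A`, so the
bound does not depend on `A`. -/
theorem norm_sum_basisCoord_le (h : ClassY a b) (m : ℕ) (x : space a b) (A : Finset Gam)
    (hA : ∀ γ ∈ A, γ.1 = m + 1) :
    ‖∑ γ ∈ A, basisCoord h γ x • basisVec h γ‖ ≤ bound b * ‖x - projX h m x‖ := by
  classical
  rw [sum_basisCoord_eq h m x A hA]
  refine norm_projL_le_of_forall h (m + 1) _ _ (norm_nonneg _) fun γ _ => ?_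
  rw [sum_smul_single_apply]
  split_ifs
  · exact LInf.abs_apply_le _ γ
  · simp

theorem sum_basisCoord_gamFinset (h : ClassY a b) (m : ℕ) (x : space a b) :
    ∑ γ ∈ gamFinset m, basisCoord h γ x • basisVec h γ = projX h m x := by
  classical
  induction m with
  | zero =>
    have h1 : gamFinset 0 = ∅ := Finset.eq_empty_of_forall_notMem fun γ hγ => by
      have := mem_gamFinset.mp hγ
      have := γ.one_le_rank
      omega
    rw [h1, Finset.sum_empty]
    refine Subtype.ext (lp.ext ?_)
    exact (proj_zero_left (a := a) (b := b) (x : LInf)).symm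
  | succ m ih =>
    have hsub : gamFinset m ⊆ gamFinset (m + 1) := fun γ hγ => by
      rw [mem_gamFinset] at hγ ⊢
      omega
    have hA : ∀ γ ∈ gamFinset (m + 1) \ gamFinset m, γ.1 = m + 1 := fun γ hγ => by
      rw [Finset.mem_sdiff, mem_gamFinset, mem_gamFinset] at hγ
      omega
    have h1 : projX h (m + 1) (x - projX h m x) = projX h (m + 1) x - projX h m x := by
      rw [map_sub, projX_projX, min_eq_right m.le_succ]
    rw [← Finset.sum_sdiff hsub, ih, sum_basisCoord_eq h m x _ hA, ← eq_sub_iff_add_eq, ← h1]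
    -- `P_{m+1}` sees only `Γ_{m+1}`, and `x - P_m x` vanishes on `Γ_m`.
    refine Subtype.ext (lp.ext ?_)
    refine proj_congr fun γ hγ => ?_
    rw [sum_smul_single_apply]
    split_ifs with h2
    · rfl
    · have h3 : γ.1 ≤ m := by
        by_contra h4
        exact h2 (by rw [Finset.mem_sdiff, mem_gamFinset, mem_gamFinset]; exact ⟨hγ, h4⟩)
      have h4 : (projX h m x : LInf) γ = (x : LInf) γ := projL_apply_of_le h _ h3
      exact (sub_eq_zero.mpr h4.symm).symm

/-- The first `N` indices consist of all of `Γ_m` and some indices of rank `m + 1`, where `m + 1` is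
the rank of `g N`. So a partial sum is `P_m x` plus an incomplete layer, which is small because `P_m
x → x`. -/
theorem norm_sum_range_sub_projX_le (h : ClassY a b) {g : ℕ ≃ Gam}
    (hg : Monotone fun i => (g i).1) (N : ℕ) (x : space a b) :
    ‖∑ i ∈ Finset.range N, basisCoord h (g i) x • basisVec h (g i) -
      projX h ((g N).1 - 1) x‖ ≤ bound b * ‖x - projX h ((g N).1 - 1) x‖ := by
  classical
  set m := (g N).1 - 1 with hm
  have hm1 : (g N).1 = m + 1 := by
    have := (g N).one_le_rank
    omega
  let F := (Finset.range N).map g.toEmbedding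
  have hF : ∀ γ, γ ∈ F ↔ g.symm γ < N := fun γ => by
    simp [F, Finset.mem_map_equiv]
  have hsub : gamFinset m ⊆ F := fun γ hγ => by
    rw [hF]
    by_contra! hN
    have h1 : (g N).1 ≤ (g (g.symm γ)).1 := hg hN
    rw [g.apply_symm_apply] at h1
    rw [mem_gamFinset] at hγ
    omega
  have hA : ∀ γ ∈ F \ gamFinset m, γ.1 = m + 1 := fun γ hγ => by
    rw [Finset.mem_sdiff, hF, mem_gamFinset] at hγ
    have h1 : (g (g.symm γ)).1 ≤ (g N).1 := hg hγ.1.le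
    rw [g.apply_symm_apply] at h1
    omega
  have h1 : ∑ i ∈ Finset.range N, basisCoord h (g i) x • basisVec h (g i) =
      ∑ γ ∈ F, basisCoord h γ x • basisVec h γ := by
    simp [F]
  rw [h1, ← Finset.sum_sdiff hsub, sum_basisCoord_gamFinset, add_sub_cancel_right]
  exact norm_sum_basisCoord_le h m x _ hA

theorem tendsto_sum_range_basisCoord (h : ClassY a b) {g : ℕ ≃ Gam}
    (hg : Monotone fun i => (g i).1) (x : space a b) :
    Tendsto (fun N => ∑ i ∈ Finset.range N, basisCoord h (g i) x • basisVec h (g i)) atTop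
      (𝓝 x) := by
  have hrank : Tendsto (fun N => (g N).1 - 1) atTop atTop := by
    rw [tendsto_atTop]
    intro n
    have h1 : (g ⁻¹' {γ : Gam | γ.1 ≤ n}).Finite :=
      (finite_rank_le n).preimage g.injective.injOn
    have h2 := h1.eventually_cofinite_notMem
    rw [Nat.cofinite_eq_atTop] at h2
    filter_upwards [h2] with N hN
    simp only [Set.mem_preimage, Set.mem_ofPred_eq] at hN
    omega
  have hP := (tendsto_projX h x).comp hrank
  have hP0 : Tendsto (fun N => bound b * ‖x - projX h ((g N).1 - 1) x‖) atTop (𝓝 0) := by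
    have := ((tendsto_const_nhds (x := x)).sub hP).norm.const_mul (bound b)
    simpa using this
  have h1 := squeeze_zero_norm (norm_sum_range_sub_projX_le h hg · x) hP0
  have h2 := h1.add hP
  rw [zero_add] at h2
  exact h2.congr fun N => sub_add_cancel _ _

/-- The Bourgain–Delbaen space has a Schauder basis. -/
theorem nonempty_schauderBasis (h : ClassY a b) : Nonempty (SchauderBasis ℝ (space a b)) := by
  obtain ⟨g, hg⟩ := exists_enumeration
  exact ⟨{
    basis := fun i => basisVec h (g i)
    coord := fun i => basisCoord h (g i)
    ortho := fun i j => by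
      rw [basisCoord_basisVec]
      by_cases hij : i = j
      · subst hij
        simp [Pi.single, Function.update]
      · simp [Pi.single, Function.update, hij]
    expansion := fun x => by
      rw [HasSum, SummationFilter.conditional_filter_eq_map_range, tendsto_map'_iff]
      exact tendsto_sum_range_basisCoord h hg x }⟩

end BourgainDelbaen

end

theorem mainTheorem9 (a b : ℝ) (hab : BourgainDelbaen.ClassY a b) :
    (¬ ∀ T : BourgainDelbaen.space a b →L[ℝ] BourgainDelbaen.space a b,
        T ∈ BourgainDelbaen.scalarPlusCompact (BourgainDelbaen.space a b)) ∧
    Nonempty (StrongDual ℝ (BourgainDelbaen.space a b) ≃L[ℝ] lp (fun _ : ℕ => ℝ) 1) ∧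
    Nonempty (SchauderBasis ℝ (BourgainDelbaen.space a b)) ∧
    TopologicalSpace.IsSeparable
      (BourgainDelbaen.scalarPlusCompact (BourgainDelbaen.space a b)) ∧
    ¬ TopologicalSpace.SeparableSpace
      (BourgainDelbaen.space a b →L[ℝ] BourgainDelbaen.space a b) := by
  have h4 := BourgainDelbaen.isSeparable_scalarPlusCompact_space hab
  have h5 := BourgainDelbaen.not_separableSpace_operators hab
  refine ⟨fun hall => h5 ?_, BourgainDelbaen.nonempty_dual_equiv_lp_one hab,
    BourgainDelbaen.nonempty_schauderBasis hab, h4, h5⟩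
  rw [← TopologicalSpace.isSeparable_univ_iff]
  exact h4.mono fun T _ => hall T
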